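/- For $m\ge 0$ let $D_m$ be the diamond hierarchical graph: $D_0$ is a single edge with its two endpoints, and $D_{m+1}$ is obtained from $D_m$ by replacing every edge $\{a,b\}$ by two new vertices, each joined to both $a$ and $b$. For a finite graph $G=(V,E)$ let $Z(G,q,v)=\sum_{E'\subseteq E}q^{k(E')}v^{|E'|}$ be the Potts model partition function, where $k(E')$ is the number of connected components of $(V,E')$. Fix $v_0\in\mathbb C$ (arbitrary). Let $\mathcal L$ be the set of all $q\in\mathbb C$ such that every neighbourhood of $q$ contains a zero of $z\mapsto Z(D_m,z,v_0)$ for infinitely many $m$, and let the continuous accumulation locus $\mathcal B_q(v_0)$ be the set of points of $\mathcal L$ that are not isolated in $\mathcal L$. For $q\in\mathbb C\setminus\{0\}$ let $F_q$ be the rational map of the Riemann sphere $\widehat{\mathbb C}$ given by $$F_q(v)=\frac{v^2(2q+4v+v^2)}{(q+2v)^2},\qquad F_q(\infty)=\infty,$$ let $F_q^m$ be its $m$-th iterate, and put $$\mathcal P^0_q(v_0)=\{q\in\mathbb C\setminus\{0\}: F_q^m(v_0)\to 0\},\qquad \mathcal P^\infty_q(v_0)=\{q\in\mathbb C\setminus\{0\}: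 F_q^m(v_0)\to\infty\}\qquad(m\to\infty).$$ The active locus $\mathcal A_q(v_0)$ is the set of $q_0\in\mathbb C\setminus\{0\}$ such that on no open neighbourhood $U\subseteq\mathbb C\setminus\{0\}$ of $q_0$ the maps $U\to\widehat{\mathbb C}$, $q\mapsto F_q^m(v_0)$ ($m\ge0$), form a normal family (with respect to the spherical metric). Then $\mathcal P^0_q(v_0)$ and $\mathcal P^\infty_q(v_0)$ are open, their boundaries within $\mathbb C\setminus\{0\}$ are equal to each other and to the active locus, $$\partial\mathcal P^0_q(v_0)\setminus\{0\}=\partial\mathcal P^\infty_q(v_0)\setminus\{0\}=\mathcal A_q(v_0),$$ the locus $\mathcal B_q(v_0)$ contains this common boundary, and $\mathcal B_q(v_0)$ is disjoint from $\mathcal P^0_q(v_0)\cup\mathcal P^\infty_q(v_0)$. -/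

import Mathlib

open Filter Topology

noncomputable section

namespace DiamondPotts

/-- Partition function of the Potts model on a finite graph, as the sum over spanning subgraphs
`(V, A)`, `A ⊆ E(G)`: `Z(G, q, v) = ∑_A q ^ k(A) * v ^ |A|`, where `k(A)` is the number of connected
components of `(V, A)`, isolated vertices included. -/
def partitionFunction {V : Type} [Finite V] (G : SimpleGraph V) (q v : ℂ) : ℂ :=
  ∑ A ∈ (Set.toFinite G.edgeSet).toFinset.powerset,
    q ^ Nat.card (SimpleGraph.fromEdgeSet (A : Set (Sym2 V))).ConnectedComponent * v ^ A.card

/-- Replace every edge `e = {a, b}` of `G` by a diamond: two new vertices `(e, false)`, `(e, true)`,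
and four edges that join each of them to `a` and to `b`. The old edges are removed. -/
def subdivide {V : Type} (G : SimpleGraph V) : SimpleGraph (V ⊕ G.edgeSet × Bool) where
  Adj x y :=
    match x, y with
    | .inl a, .inr (e, _) => a ∈ (e : Sym2 V)
    | .inr (e, _), .inl a => a ∈ (e : Sym2 V)
    | _, _ => False
  symm := ⟨by
    rintro (a | ⟨e, i⟩) (b | ⟨f, j⟩) h
    · exact h
    · exact h
    · exact h
    · exact h⟩
  loopless := ⟨by
    rintro (a | ⟨e, i⟩) h
    · exact h
    · exact h⟩

/-- A finite simple graph together with its vertex type. -/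
structure FiniteGraph where
  V : Type
  finite : Finite V
  graph : SimpleGraph V

attribute [instance] FiniteGraph.finite

/-- The diamond hierarchical graphs: `D 0` is a single edge with its two end points, and `D (m + 1)`
arises from `D m` by replacing every edge by a diamond. -/
def D : ℕ → FiniteGraph
  | 0 => ⟨Bool, inferInstance, ⊤⟩
  | m + 1 => ⟨(D m).V ⊕ (D m).graph.edgeSet × Bool, inferInstance, subdivide (D m).graph⟩

/-- `Z(D_m, q, v)`. -/
def Z (m : ℕ) (q v : ℂ) : ℂ := partitionFunction (D m).graph q v

/-- The accumulation set, as `m → ∞`, of the zeros of `q ↦ Z(D_m, q, v₀)`: every neighbourhood of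
the point contains a zero of `Z(D_m, ·, v₀)` for infinitely many `m`. -/
def accumulationSet (v₀ : ℂ) : Set ℂ :=
  {q | ∀ U ∈ 𝓝 q, ∃ᶠ m in atTop, ∃ z ∈ U, Z m z v₀ = 0}

/-- The continuous accumulation locus `ℬ_q(v₀)`: the points of the accumulation set that are not
isolated in it. -/
def B (v₀ : ℂ) : Set ℂ :=
  {q | q ∈ accumulationSet v₀ ∧ AccPt q (𝓟 (accumulationSet v₀))}

/-- The renormalization map `F_q(v) = v² (2q + 4v + v²) / (q + 2v)²` of the Riemann sphere, for
`q ≠ 0`. For such `q` the numerator does not vanish at the pole `v = -q/2`. -/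
def F (q : ℂ) : OnePoint ℂ → OnePoint ℂ
  | none => OnePoint.infty
  | some v =>
    if q + 2 * v = 0 then OnePoint.infty
    else ((v ^ 2 * (2 * q + 4 * v + v ^ 2) / (q + 2 * v) ^ 2 : ℂ) : OnePoint ℂ)

/-- The orbit `F_q^m(v₀)` of the constant marked point `v₀`, as a function of the parameter `q`. -/
def orbit (v₀ : ℂ) (m : ℕ) (q : ℂ) : OnePoint ℂ := (F q)^[m] (v₀ : OnePoint ℂ)

/-- The parameters `q ≠ 0` with `F_q^m(v₀) → 0`. -/
def P0 (v₀ : ℂ) : Set ℂ :=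
  {q | q ≠ 0 ∧ Tendsto (fun m => orbit v₀ m q) atTop (𝓝 ((0 : ℂ) : OnePoint ℂ))}

/-- The parameters `q ≠ 0` with `F_q^m(v₀) → ∞`. -/
def PInfty (v₀ : ℂ) : Set ℂ :=
  {q | q ≠ 0 ∧ Tendsto (fun m => orbit v₀ m q) atTop (𝓝 (OnePoint.infty : OnePoint ℂ))}

/-- Local uniform convergence on `U` of maps into the Riemann sphere, with respect to the unique
uniform structure of this compact Hausdorff space (that of the spherical metric). -/
def SphereTendstoLocallyUniformlyOn (f : ℕ → ℂ → OnePoint ℂ) (g : ℂ → OnePoint ℂ) (U : Set ℂ) :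
    Prop :=
  letI : UniformSpace (OnePoint ℂ) := uniformSpaceOfCompactR1
  TendstoLocallyUniformlyOn f g atTop U

/-- The family `{f m}` is normal on `U`: every sequence in it has a subsequence that converges
locally uniformly on `U`, in the spherical sense. -/
def IsNormalOn (f : ℕ → ℂ → OnePoint ℂ) (U : Set ℂ) : Prop :=
  ∀ s : ℕ → ℕ, ∃ t : ℕ → ℕ, StrictMono t ∧
    ∃ g : ℂ → OnePoint ℂ, SphereTendstoLocallyUniformlyOn (fun k => f (s (t k))) g U

/-- The marked point `v₀` is passive at `q₀`: the maps `q ↦ F_q^m(v₀)` form a normal family on an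
open neighbourhood of `q₀` in the parameter space `ℂ \ {0}`. -/
def IsPassive (v₀ q₀ : ℂ) : Prop :=
  ∃ U : Set ℂ, IsOpen U ∧ q₀ ∈ U ∧ (0 : ℂ) ∉ U ∧ IsNormalOn (orbit v₀) U

/-- The active locus `𝒜_q(v₀)` in `ℂ \ {0}`. -/
def A (v₀ : ℂ) : Set ℂ := {q | q ≠ 0 ∧ ¬ IsPassive v₀ q}

end DiamondPotts

end

/-! Summing out the two middle vertices of every diamond turns the Potts weights of `D (m + 1)` into
those of `D m`. In homogeneous coordinates this gives `Z_eq`: for `q ≠ 0`, `q` is a zero of `Z(D_m,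
·, v₀)` exactly when `F_q^m(v₀) = -q`.

The points 0 and ∞ are superattracting for `F_q`, with trapping discs uniform in `q` locally. Hence
the two basins are open, and since a zero needs `v = -q`, zeros stay away from them. A passive
parameter in the closure of a basin lies in it, because a continuous limit map forces one visit to
the trap. Off the closure of a basin the orbits avoid a fixed disc, so Montel's theorem gives
passivity. Both boundaries are therefore the active locus.

The core is `mem_accumulationSet_of_mem_A`. Since `liftMap` is homogeneous of degree 4, `4^{-m} log
‖lift‖` converges to an escape rate `G`. If no late zeros occur near an active `q₀ ≠ 1`, then
`4^{-m} log |zeroForm|` is harmonic there and at most `G + o(1)`. As `F_q(-q) = q² - 2q` equals `-q`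
only for `q = 0` or `q = 1`, two consecutive orbit points cannot both be near `-q`, so the larger of
two consecutive rates is at least `G - o(1)`. Along a subsequence both converge to harmonic
functions that agree on the basin of 0, hence everywhere, and the common limit is `G`. Then `G = Re
ψ` with `ψ` holomorphic, and rescaling the lift by `exp(-4^m ψ)` makes the orbit normal,
contradicting activity.

The exception `q₀ = 1` is reached by approximation: the active locus has no isolated points
(`accPt_A`), which also gives non-isolation in the accumulation set. -/

noncomputable section

namespace DiamondPotts

/-! ### Potts sums under replacement of edges by diamonds -/

/-- `a` and `b` are the ends of an edge selected by `σ`. -/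
def Joined {V E : Type} (inc : E → Sym2 V) (σ : E → Bool) (a b : V) : Prop :=
  ∃ e, σ e = true ∧ inc e = s(a, b)

open Classical in
/-- The homogeneous Potts sum of a multigraph given by its incidence map. -/
def pottsSum {V E : Type} [Fintype E] (inc : E → Sym2 V) (q x y : ℂ) : ℂ :=
  ∑ σ : E → Bool, q ^ Nat.card (Quot (Joined inc σ)) * ∏ e, if σ e then x else y

theorem pottsSum_comp_equiv {V E E' : Type} [Fintype E] [Fintype E'] (φ : E' ≃ E)
    (inc : E → Sym2 V) (q x y : ℂ) : pottsSum (inc ∘ φ) q x y = pottsSum inc q x y := by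
  classical
  unfold pottsSum
  refine Fintype.sum_equiv (φ.arrowCongr (Equiv.refl Bool)) _ _ fun σ => ?_
  congr 1
  · congr 2
    have : Joined (inc ∘ φ) σ = Joined inc (φ.arrowCongr (Equiv.refl Bool) σ) := by
      funext a b
      simp only [Joined, eq_iff_iff]
      constructor
      · rintro ⟨e, h1, h2⟩
        exact ⟨φ e, by simpa using h1, h2⟩
      · rintro ⟨e, h1, h2⟩
        exact ⟨φ.symm e, by simpa using h1, by simpa using h2⟩
    rw [this]
  · refine Fintype.prod_equiv φ _ _ fun e => ?_
    simp

/-- `fromEdgeSet` discards loops, but a loop never merges two classes. -/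
theorem card_connectedComponent_fromEdgeSet {V : Type} (S : Set (Sym2 V)) :
    Nat.card (SimpleGraph.fromEdgeSet S).ConnectedComponent =
      Nat.card (Quot fun a b => s(a, b) ∈ S) := by
  refine Nat.card_congr ⟨?_, ?_, ?_, ?_⟩
  · refine Quot.lift (fun a => Quot.mk _ a) ?_
    rintro a b ⟨w⟩
    induction w with
    | nil => rfl
    | cons h _ ih =>
      exact (Quot.sound (by simpa using ((SimpleGraph.fromEdgeSet_adj S).1 h).1)).trans ih
  · refine Quot.lift (fun a => SimpleGraph.connectedComponentMk _ a) fun a b h => ?_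
    by_cases hab : a = b
    · rw [hab]
    · exact SimpleGraph.ConnectedComponent.sound
        (SimpleGraph.Adj.reachable ((SimpleGraph.fromEdgeSet_adj S).2 ⟨h, hab⟩))
  · rintro ⟨a⟩; rfl
  · rintro ⟨a⟩; rfl

theorem partitionFunction_eq_pottsSum {V : Type} [Finite V] (G : SimpleGraph V)
    [Fintype G.edgeSet] (q v : ℂ) :
    partitionFunction G q v = pottsSum (Subtype.val : G.edgeSet → Sym2 V) q v 1 := by
  classical
  unfold partitionFunction pottsSum
  refine Finset.sum_bij' (fun A _ e => decide (e.1 ∈ A))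
    (fun σ _ => (Finset.univ.filter fun e => σ e = true).map (Function.Embedding.subtype _))
    ?_ ?_ ?_ ?_ ?_
  · simp
  · intro σ _
    simp only [Finset.mem_powerset]
    intro e he
    simp only [Finset.mem_map, Finset.mem_filter, Finset.mem_univ, true_and] at he
    obtain ⟨a, _, rfl⟩ := he
    simp
  · intro A hA
    rw [Finset.mem_powerset] at hA
    ext e
    simp only [Finset.mem_map, Finset.mem_filter, Finset.mem_univ, true_and, decide_eq_true_eq,
      Function.Embedding.subtype_apply]
    constructor
    · rintro ⟨a, h, rfl⟩; exact h
    · intro h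
      have := hA h
      rw [Set.Finite.mem_toFinset] at this
      exact ⟨⟨e, this⟩, h, rfl⟩
  · intro σ _
    funext e
    simp
  · intro A hA
    rw [Finset.mem_powerset] at hA
    have hA' : ∀ e ∈ A, e ∈ G.edgeSet := fun e he => by
      simpa using hA he
    congr 1
    · rw [card_connectedComponent_fromEdgeSet]
      have : (fun a b => s(a, b) ∈ (A : Set (Sym2 V))) =
          Joined (Subtype.val : G.edgeSet → Sym2 V) fun e => decide (e.1 ∈ A) := by
        funext a b
        simp only [Joined, eq_iff_iff, decide_eq_true_eq]
        constructor
        · intro h; exact ⟨⟨_, hA' _ h⟩, h, rfl⟩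
        · rintro ⟨e, h1, h2⟩
          rw [← h2]; exact h1
      rw [this]
    · simp only [decide_eq_true_eq]
      rw [Finset.prod_ite]
      simp only [Finset.prod_const, one_pow, mul_one]
      congr 1
      rw [← Finset.card_map (Function.Embedding.subtype _)]
      congr 1
      ext e
      simp only [Finset.mem_map, Finset.mem_filter, Finset.mem_univ, true_and,
        Function.Embedding.subtype_apply]
      constructor
      · intro h; exact ⟨⟨e, hA' e h⟩, h, rfl⟩
      · rintro ⟨a, h, rfl⟩; exact h

/-- Incidence map of the graph in which every edge `e`, with ends `p e false` and `p e true`, is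
replaced by a diamond. -/
def diamondInc {V E : Type} (p : E → Bool → V) : E × Bool × Bool → Sym2 (V ⊕ E × Bool) :=
  fun h => s(.inl (p h.1 h.2.2), .inr (h.1, h.2.1))

/-- The ends of `e` are joined through one of the two new vertices. -/
def conn (s : Bool × Bool × Bool × Bool) : Bool := (s.1 && s.2.1) || (s.2.2.1 && s.2.2.2)

/-- The number of new vertices of a diamond that are isolated. -/
def isolatedCount (s : Bool × Bool × Bool × Bool) : ℕ :=
  (if s.1 || s.2.1 then 0 else 1) + (if s.2.2.1 || s.2.2.2 then 0 else 1)

/-- The product of the weights of the four edges of a diamond. -/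
def edgeWeight (x y : ℂ) (s : Bool × Bool × Bool × Bool) : ℂ :=
  (if s.1 then x else y) * (if s.2.1 then x else y) * (if s.2.2.1 then x else y) *
    (if s.2.2.2 then x else y)

/-- A selection of edges of the diamond graph, as a selection of edges for each diamond. -/
def diamondState {E : Type} :
    (E × Bool × Bool → Bool) ≃ (E → Bool × Bool × Bool × Bool) where
  toFun σ e := (σ (e, false, false), σ (e, false, true), σ (e, true, false), σ (e, true, true))
  invFun ω h := match h with
    | (e, false, false) => (ω e).1
    | (e, false, true) => (ω e).2.1
    | (e, true, false) => (ω e).2.2.1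
    | (e, true, true) => (ω e).2.2.2
  left_inv σ := by
    funext ⟨e, i, j⟩
    cases i <;> cases j <;> rfl
  right_inv ω := rfl

/-- A new vertex with a selected edge is absorbed into the class of an old one; without any it is a
component by itself. Old ends are merged by a diamond only through a middle vertex with both edges
selected. -/
theorem card_quot_diamondInc {V E : Type} [Finite V] [Fintype E] (inc : E → Sym2 V)
    (p : E → Bool → V) (hp : ∀ e, inc e = s(p e false, p e true)) (σ : E × Bool × Bool → Bool) :
    Nat.card (Quot (Joined (diamondInc p) σ)) =
      Nat.card (Quot (Joined inc fun e => conn (diamondState σ e))) +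
        ∑ e, isolatedCount (diamondState σ e) := by
  classical
  set r := Joined inc fun e => conn (diamondState σ e)
  let iso : Type := {h : E × Bool // ¬ (σ (h.1, h.2, false) = true ∨ σ (h.1, h.2, true) = true)}
  have hconn : ∀ e i, σ (e, i, false) = true → σ (e, i, true) = true →
      Quot.mk r (p e false) = Quot.mk r (p e true) := fun e i h1 h2 =>
    Quot.sound ⟨e, by cases i <;> simp [conn, diamondState, h1, h2], hp e⟩
  -- A new vertex attached to both ends is sent to the class of the `false` end; by `hconn` the
  -- choice does not matter.
  let f : V ⊕ E × Bool → Quot r ⊕ iso := Sum.elim (fun a => .inl (Quot.mk _ a)) fun h =>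
    if h1 : σ (h.1, h.2, false) = true then .inl (Quot.mk _ (p h.1 false))
    else if h2 : σ (h.1, h.2, true) = true then .inl (Quot.mk _ (p h.1 true))
    else .inr ⟨h, not_or.2 ⟨h1, h2⟩⟩
  have hf : ∀ e i j, σ (e, i, j) = true → f (.inl (p e j)) = f (.inr (e, i)) := by
    intro e i j h
    cases j
    · simp [f, h]
    · by_cases h1 : σ (e, i, false) = true
      · simp [f, h1, hconn e i h1 h]
      · simp [f, h1, h]
  have hq : ∀ e i j, σ (e, i, j) = true →
      Quot.mk (Joined (diamondInc p) σ) (.inl (p e j)) = Quot.mk _ (.inr (e, i)) :=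
    fun e i j h => Quot.sound ⟨(e, i, j), h, rfl⟩
  have hq2 : ∀ e, conn (diamondState σ e) = true →
      Quot.mk (Joined (diamondInc p) σ) (.inl (p e false)) = Quot.mk _ (.inl (p e true)) := by
    intro e h
    simp only [conn, diamondState, Equiv.coe_fn_mk, Bool.or_eq_true, Bool.and_eq_true] at h
    rcases h with h | h
    · exact (hq _ _ _ h.1).trans (hq _ _ _ h.2).symm
    · exact (hq _ _ _ h.1).trans (hq _ _ _ h.2).symm
  have key : Quot (Joined (diamondInc p) σ) ≃ Quot r ⊕ iso :=
    { toFun := Quot.lift f (by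
        rintro a b ⟨⟨e, i, j⟩, h, hab⟩
        rcases Sym2.eq_iff.1 hab with ⟨rfl, rfl⟩ | ⟨rfl, rfl⟩
        · exact hf e i j h
        · exact (hf e i j h).symm)
      invFun := Sum.elim (Quot.lift (fun a => Quot.mk _ (.inl a)) (by
        rintro a b ⟨e, h, hab⟩
        rw [hp] at hab
        rcases Sym2.eq_iff.1 hab with ⟨rfl, rfl⟩ | ⟨rfl, rfl⟩
        · exact hq2 e h
        · exact (hq2 e h).symm)) fun h => Quot.mk _ (.inr h.1)
      left_inv := by
        rintro ⟨a | ⟨e, i⟩⟩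
        · rfl
        · by_cases h1 : σ (e, i, false) = true
          · simpa [f, h1] using hq _ _ _ h1
          · by_cases h2 : σ (e, i, true) = true
            · simpa [f, h1, h2] using hq _ _ _ h2
            · simp [f, h1, h2]
      right_inv := by
        rintro (a | ⟨⟨e, i⟩, h⟩)
        · induction a using Quot.ind
          rfl
        · have h' := not_or.1 h
          simp [f, h'.1, h'.2] }
  rw [Nat.card_congr key, Nat.card_sum]
  congr 1
  rw [Nat.card_eq_fintype_card, Fintype.card_subtype, Finset.card_filter, Fintype.sum_prod_type]
  refine Finset.sum_congr rfl fun e _ => ?_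
  simp only [Fintype.sum_bool, isolatedCount, diamondState, Equiv.coe_fn_mk, Bool.or_eq_true,
    ite_not]
  ring

/-- The component count is additive over diamonds, so for a fixed pattern of connected diamonds each
one is summed out independently and acts as a single edge with new weights. -/
theorem pottsSum_diamondInc {V E : Type} [Finite V] [Fintype E] (inc : E → Sym2 V)
    (p : E → Bool → V) (hp : ∀ e, inc e = s(p e false, p e true)) (q x y : ℂ) :
    pottsSum (diamondInc p) q x y =
      pottsSum inc q (x ^ 2 * (2 * q * y ^ 2 + 4 * x * y + x ^ 2))
        (y ^ 2 * (q * y + 2 * x) ^ 2) := by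
  classical
  set w : Bool × Bool × Bool × Bool → ℂ := fun s => q ^ isolatedCount s * edgeWeight x y s
  have h1 : pottsSum (diamondInc p) q x y = ∑ ω : E → Bool × Bool × Bool × Bool,
      q ^ Nat.card (Quot (Joined inc fun e => conn (ω e))) * ∏ e, w (ω e) := by
    unfold pottsSum
    refine Finset.sum_equiv diamondState (by simp) fun σ _ => ?_
    rw [card_quot_diamondInc inc p hp, pow_add, mul_assoc, Finset.prod_mul_distrib,
      Finset.prod_pow_eq_pow_sum, Fintype.prod_prod_type]
    congr 2
    refine Finset.prod_congr rfl fun e _ => ?_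
    simp only [Fintype.prod_prod_type, Fintype.prod_bool, edgeWeight, diamondState,
      Equiv.coe_fn_mk]
    split_ifs <;> simp only [*, if_true, if_false, Bool.false_eq_true] <;> ring
  -- A middle vertex contributes `x²` if it connects the ends and `q y² + 2xy` if not. Two
  -- non-connecting ones give the second weight; all other combinations add up to the first.
  have h2 : ∀ b : Bool, ∑ s with conn s = b, w s =
      if b then x ^ 2 * (2 * q * y ^ 2 + 4 * x * y + x ^ 2) else y ^ 2 * (q * y + 2 * x) ^ 2 := by
    intro b
    rw [Finset.sum_filter]
    cases b <;>
    · simp only [Fintype.sum_prod_type, Fintype.sum_bool]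
      simp [conn, w, isolatedCount, edgeWeight]
      ring
  rw [h1, pottsSum, ← Finset.sum_fiberwise Finset.univ
    (fun (ω : E → Bool × Bool × Bool × Bool) (e : E) => conn (ω e))]
  refine Finset.sum_congr rfl fun σ _ => ?_
  rw [← Finset.prod_congr rfl fun e _ => h2 (σ e), Finset.prod_univ_sum, Finset.mul_sum]
  refine Finset.sum_congr ?_ fun ω hω => ?_
  · ext ω
    simp [Fintype.mem_piFinset, funext_iff]
  · have : (fun e => conn (ω e)) = σ := by
      funext e
      simpa using Fintype.mem_piFinset.1 hω e
    rw [this]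

/-- The half-edges of the diamonds are the edges of the subdivided graph. -/
theorem exists_equiv_edgeSet_subdivide {V : Type} (G : SimpleGraph V) (p : G.edgeSet → Bool → V)
    (hp : ∀ e, e.1 = s(p e false, p e true)) :
    ∃ φ : G.edgeSet × Bool × Bool ≃ (subdivide G).edgeSet,
      (Subtype.val : (subdivide G).edgeSet → _) ∘ φ = diamondInc p := by
  have hmem : ∀ e j, p e j ∈ e.1 := by
    intro e j
    rw [hp]
    cases j <;> simp
  have hne : ∀ e, p e false ≠ p e true := by
    intro e h
    have h2 := e.2
    rw [hp, h, SimpleGraph.mem_edgeSet] at h2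
    exact G.loopless.irrefl _ h2
  let f : G.edgeSet × Bool × Bool → (subdivide G).edgeSet :=
    fun h => ⟨diamondInc p h, by
      rw [diamondInc, SimpleGraph.mem_edgeSet]
      exact hmem _ _⟩
  refine ⟨Equiv.ofBijective f ⟨?_, ?_⟩, rfl⟩
  · rintro ⟨e, i, j⟩ ⟨e', i', j'⟩ h
    have h' : diamondInc p (e, i, j) = diamondInc p (e', i', j') := congrArg Subtype.val h
    simp only [diamondInc] at h'
    rcases Sym2.eq_iff.1 h' with ⟨h1, h2⟩ | ⟨h1, h2⟩
    · obtain ⟨rfl, rfl⟩ := Prod.mk.inj (Sum.inr_injective h2)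
      have h3 := Sum.inl_injective h1
      have : j = j' := by
        cases j <;> cases j' <;>
          first | rfl | exact absurd h3 (hne e) | exact absurd h3.symm (hne e)
      rw [this]
    · cases h1
  · have aux : ∀ (a : V) (e : G.edgeSet) (i : Bool), a ∈ e.1 →
        ∃ j, diamondInc p (e, i, j) = s(.inl a, .inr (e, i)) := by
      intro a e i h
      rw [hp, Sym2.mem_iff] at h
      rcases h with rfl | rfl
      · exact ⟨false, rfl⟩
      · exact ⟨true, rfl⟩
    rintro ⟨z, hz⟩
    induction z using Sym2.ind with
    | _ u v =>
      rcases u with a | ⟨e, i⟩ <;> rcases v with b | ⟨e', i'⟩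
      · exact absurd ((SimpleGraph.mem_edgeSet _).1 hz) (by simp [subdivide])
      · obtain ⟨j, hj⟩ := aux a e' i' ((SimpleGraph.mem_edgeSet _).1 hz)
        exact ⟨(e', i', j), Subtype.ext hj⟩
      · obtain ⟨j, hj⟩ := aux b e i ((SimpleGraph.mem_edgeSet _).1 hz)
        exact ⟨(e, i, j), Subtype.ext (hj.trans Sym2.eq_swap)⟩
      · exact absurd ((SimpleGraph.mem_edgeSet _).1 hz) (by simp [subdivide])

theorem pottsSum_subdivide {V : Type} [Finite V] (G : SimpleGraph V) [Fintype G.edgeSet]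
    [Fintype (subdivide G).edgeSet] (q x y : ℂ) :
    pottsSum (Subtype.val : (subdivide G).edgeSet → _) q x y =
      pottsSum (Subtype.val : G.edgeSet → _) q (x ^ 2 * (2 * q * y ^ 2 + 4 * x * y + x ^ 2))
        (y ^ 2 * (q * y + 2 * x) ^ 2) := by
  have hp : ∀ e : G.edgeSet, ∃ p : Bool → V, e.1 = s(p false, p true) := by
    rintro ⟨e, he⟩
    induction e using Sym2.ind with
    | _ a b => exact ⟨fun j => if j then b else a, rfl⟩
  choose p hp using hp
  obtain ⟨φ, hφ⟩ := exists_equiv_edgeSet_subdivide G p hp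
  rw [← pottsSum_comp_equiv φ, hφ, pottsSum_diamondInc _ p hp]

/-! ### The renormalization recursion for the partition functions -/

/-- One step of the renormalization map in homogeneous coordinates. -/
def liftMap (q : ℂ) (w : ℂ × ℂ) : ℂ × ℂ :=
  (w.1 ^ 2 * (2 * q * w.2 ^ 2 + 4 * w.1 * w.2 + w.1 ^ 2), w.2 ^ 2 * (q * w.2 + 2 * w.1) ^ 2)

/-- The orbit of `v₀` in homogeneous coordinates. -/
def lift (v₀ : ℂ) (m : ℕ) (q : ℂ) : ℂ × ℂ := (liftMap q)^[m] (v₀, 1)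

theorem lift_succ (v₀ : ℂ) (m : ℕ) (q : ℂ) : lift v₀ (m + 1) q = liftMap q (lift v₀ m q) :=
  Function.iterate_succ_apply' _ _ _

theorem pottsSum_top_bool [Fintype (⊤ : SimpleGraph Bool).edgeSet] (q x y : ℂ) :
    pottsSum (Subtype.val : (⊤ : SimpleGraph Bool).edgeSet → _) q x y = q * (q * y + x) := by
  classical
  let φ : Unit ≃ (⊤ : SimpleGraph Bool).edgeSet :=
    { toFun := fun _ => ⟨s(false, true), by simp⟩
      invFun := fun _ => ()
      left_inv := fun _ => rfl
      right_inv := by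
        rintro ⟨e, he⟩
        apply Subtype.ext
        induction e using Sym2.ind with
        | _ a b =>
          have hab : a ≠ b := SimpleGraph.Adj.ne ((SimpleGraph.mem_edgeSet _).1 he)
          revert hab
          cases a <;> cases b <;> simp [Sym2.eq_swap] }
  have h1 : Nat.card (Quot (Joined ((Subtype.val : (⊤ : SimpleGraph Bool).edgeSet → _) ∘ φ)
      fun _ => true)) = 1 := by
    rw [Nat.card_eq_one_iff_unique]
    refine ⟨⟨?_⟩, ⟨Quot.mk _ true⟩⟩
    have : ∀ a : Quot (Joined ((Subtype.val : (⊤ : SimpleGraph Bool).edgeSet → _) ∘ φ)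
      fun _ => true), a = Quot.mk _ true := by
      intro a
      induction a using Quot.ind with
      | mk a =>
        cases a
        · exact Quot.sound ⟨(), rfl, rfl⟩
        · rfl
    intro a b
    rw [this a, this b]
  have h2 : Nat.card (Quot (Joined ((Subtype.val : (⊤ : SimpleGraph Bool).edgeSet → _) ∘ φ)
      fun _ => false)) = 2 := by
    rw [← Fintype.card_bool, ← Nat.card_eq_fintype_card]
    refine Nat.card_congr ⟨Quot.lift id ?_, Quot.mk _, ?_, fun _ => rfl⟩
    · rintro a b ⟨e, h, _⟩
      cases h
    · rintro ⟨a⟩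
      rfl
  rw [← pottsSum_comp_equiv φ, pottsSum,
    Finset.sum_equiv (t := Finset.univ) (Equiv.funUnique Unit Bool)
      (g := fun b => q ^ Nat.card (Quot (Joined ((Subtype.val : (⊤ : SimpleGraph Bool).edgeSet → _)
        ∘ φ) fun _ => b)) * if b then x else y) (by simp) ?_]
  · rw [Fintype.sum_bool, h1, h2]
    simp
    ring
  · intro σ _
    obtain ⟨b, rfl⟩ : ∃ b, σ = fun _ => b := ⟨σ (), rfl⟩
    simp

/-- The induction removes the last subdivision first, which transforms the initial weights; hence
the weights `w` are arbitrary. -/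
theorem pottsSum_D (m : ℕ) (inst : Fintype (D m).graph.edgeSet) (q : ℂ) (w : ℂ × ℂ) :
    pottsSum (Subtype.val : (D m).graph.edgeSet → _) q w.1 w.2 =
      q * (q * ((liftMap q)^[m] w).2 + ((liftMap q)^[m] w).1) := by
  induction m generalizing w with
  | zero => exact @pottsSum_top_bool inst q w.1 w.2
  | succ m ih =>
    have inst' : Fintype (D m).graph.edgeSet := Fintype.ofFinite _
    rw [Function.iterate_succ_apply, ← ih inst' (liftMap q w)]
    exact @pottsSum_subdivide _ _ (D m).graph inst' inst q w.1 w.2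

theorem Z_eq (m : ℕ) (q v₀ : ℂ) :
    Z m q v₀ = q * (q * (lift v₀ m q).2 + (lift v₀ m q).1) := by
  have inst : Fintype (D m).graph.edgeSet := Fintype.ofFinite _
  rw [Z, partitionFunction_eq_pottsSum]
  exact pottsSum_D m inst q (v₀, 1)

/-! ### Normal families, logarithms and the Borel–Carathéodory bound -/

open Metric in
/-- Montel's theorem for bounded sequences of holomorphic functions on a ball. -/
theorem exists_subseq_tendstoUniformlyOn {F : Type*} [NormedAddCommGroup F] [NormedSpace ℂ F]
    [ProperSpace F] {f : ℕ → ℂ → F} {c : ℂ} {R C : ℝ} (hR : 0 < R)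
    (hf : ∀ n, DifferentiableOn ℂ (f n) (ball c (2 * R)))
    (hC : ∀ n, ∀ z ∈ ball c (2 * R), ‖f n z‖ ≤ C) :
    ∃ φ : ℕ → ℕ, StrictMono φ ∧ ∃ g : ℂ → F, ContinuousOn g (closedBall c R) ∧
      TendstoUniformlyOn (fun k => f (φ k)) g atTop (closedBall c R) := by
  classical
  -- Cauchy's estimate on circles of radius `R / 2`, which stay in the large ball, gives the common
  -- Lipschitz constant for Arzelà–Ascoli.
  have hderiv : ∀ n, ∀ z ∈ closedBall c R, ‖deriv (f n) z‖ ≤ C / (R / 2) := by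
    intro n z hz
    have hsub : closedBall z (R / 2) ⊆ ball c (2 * R) := by
      intro w hw
      rw [mem_closedBall] at *
      rw [mem_ball]
      linarith [dist_triangle w z c]
    refine Complex.norm_deriv_le_of_forall_mem_sphere_norm_le (by positivity) ?_
      fun w hw => hC n w (hsub (sphere_subset_closedBall hw))
    exact ((hf n).mono hsub).diffContOnCl_ball le_rfl
  have hsub : closedBall c R ⊆ ball c (2 * R) := closedBall_subset_ball (by linarith)
  have hlip : ∀ n, ∀ z ∈ closedBall c R, ∀ w ∈ closedBall c R,
      ‖f n w - f n z‖ ≤ C / (R / 2) * ‖w - z‖ := fun n z hz w hw =>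
    Convex.norm_image_sub_le_of_norm_deriv_le
      (fun x hx => (hf n).differentiableAt (isOpen_ball.mem_nhds (hsub hx))) (hderiv n)
      (convex_closedBall c R) hz hw
  let K := closedBall c R
  have : CompactSpace K := isCompact_iff_compactSpace.1 (isCompact_closedBall c R)
  let G : ℕ → BoundedContinuousFunction K F := fun n =>
    BoundedContinuousFunction.mkOfCompact
      ⟨K.domRestrict (f n), ((hf n).continuousOn.mono hsub).domRestrict⟩
  have hcomp : IsCompact (closure (Set.range G)) := by
    refine BoundedContinuousFunction.arzela_ascoli (closedBall (0 : F) C) (isCompact_closedBall _ _)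
      _ ?_ ?_
    · rintro _ x ⟨n, rfl⟩
      rw [mem_closedBall_zero_iff]
      exact hC n x (hsub x.2)
    · refine Metric.equicontinuous_of_continuity_modulus (fun t => C / (R / 2) * t) ?_ _ ?_
      · have : Continuous fun t : ℝ => C / (R / 2) * t := by fun_prop
        simpa using this.tendsto 0
      · rintro x y ⟨_, n, rfl⟩
        rw [dist_eq_norm, Subtype.dist_eq, dist_eq_norm]
        exact hlip n y y.2 x x.2
  obtain ⟨g, -, φ, hφ, hg⟩ := hcomp.tendsto_subseq fun n => subset_closure (Set.mem_range_self n)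
  rw [BoundedContinuousFunction.tendsto_iff_tendstoUniformly] at hg
  let g' : ℂ → F := fun z => if h : z ∈ K then g ⟨z, h⟩ else 0
  have hg' : TendstoUniformlyOn (fun k => f (φ k)) g' atTop (closedBall c R) := by
    rw [tendstoUniformlyOn_iff_tendstoUniformly_comp_coe]
    have : g' ∘ ((↑) : K → ℂ) = g := by
      funext x
      simp [g', x.2]
    rw [this]
    exact hg
  refine ⟨φ, hφ, g', ?_, hg'⟩
  exact hg'.continuousOn (Frequently.of_forall fun n => (hf _).continuousOn.mono hsub)

open Metric in
/-- A nonvanishing holomorphic function on a ball has a holomorphic logarithm. -/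
theorem exists_log_of_ne_zero {f : ℂ → ℂ} {c : ℂ} {r : ℝ} (hr : 0 < r)
    (hf : DifferentiableOn ℂ f (ball c r)) (h0 : ∀ z ∈ ball c r, f z ≠ 0) :
    ∃ ψ : ℂ → ℂ, DifferentiableOn ℂ ψ (ball c r) ∧ (∀ z ∈ ball c r, Complex.exp (ψ z) = f z) ∧
      ψ c = Complex.log (f c) := by
  have hd : DifferentiableOn ℂ (fun z => deriv f z / f z) (ball c r) :=
    (hf.deriv isOpen_ball).div hf h0
  obtain ⟨ψ, hψc, hψ⟩ := hd.isExactOn_ball.with_val_at c (Complex.log (f c))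
  have hc := mem_ball_self (x := c) hr
  refine ⟨ψ, fun z hz => (hψ z hz).differentiableAt.differentiableWithinAt, ?_, hψc⟩
  -- `ψ` is a primitive of `f' / f`, so `f * exp (-ψ)` is constant.
  have hder : ∀ z ∈ ball c r, HasDerivAt (fun w => f w * Complex.exp (-ψ w)) 0 z := by
    intro z hz
    have h1 := (hf.differentiableAt (isOpen_ball.mem_nhds hz)).hasDerivAt
    have h2 := h0 z hz
    refine (h1.mul (hψ z hz).neg.cexp).congr_deriv ?_
    field_simp
    ring
  intro z hz
  have hconst : f z * Complex.exp (-ψ z) = f c * Complex.exp (-ψ c) :=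
    (convex_ball c r).is_const_of_fderivWithin_eq_zero (𝕜 := ℂ)
      (f := fun w => f w * Complex.exp (-ψ w))
      (fun w hw => (hder w hw).differentiableAt.differentiableWithinAt)
      (fun w hw => by
        rw [fderivWithin_of_isOpen isOpen_ball hw]
        ext
        simpa using (hder w hw).deriv) hz hc
  rw [hψc, Complex.exp_neg, Complex.exp_neg, Complex.exp_log (h0 c hc),
    mul_inv_cancel₀ (h0 c hc)] at hconst
  exact (eq_of_mul_inv_eq_one hconst).symm

open Metric in
/-- A holomorphic function whose real part is bounded above is bounded on a smaller ball. -/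
theorem norm_le_of_re_le {f : ℂ → ℂ} {c : ℂ} {R M K : ℝ} (hR : 0 < R) (hM : 0 < M)
    (hf : DifferentiableOn ℂ f (ball c (2 * R))) (hre : ∀ z ∈ ball c (2 * R), (f z).re ≤ M)
    (hc : ‖f c‖ ≤ K) {z : ℂ} (hz : z ∈ ball c R) : ‖f z‖ ≤ 2 * M + 3 * K := by
  have hmap : ∀ w ∈ ball (0 : ℂ) (2 * R), c + w ∈ ball c (2 * R) := by
    intro w hw
    simpa using hw
  have hz' : ‖z - c‖ < R := by simpa [dist_eq_norm] using hz
  have key := Complex.borelCaratheodory (f := fun w => f (c + w)) (z := z - c) hM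
    (hf.comp (by fun_prop) hmap) (fun w hw => hre _ (hmap w hw)) (by linarith)
    (by rw [mem_ball_zero_iff]; linarith)
  simp only [add_sub_cancel, add_zero] at key
  set t := ‖z - c‖
  have ht : 0 ≤ t := norm_nonneg _
  have hpos : 0 < 2 * R - t := by linarith
  -- Since `t < R`, one has `t / (2R - t) ≤ 1` and `(2R + t) / (2R - t) ≤ 3`.
  refine key.trans (add_le_add ?_ ?_)
  · rw [div_le_iff₀ hpos]
    nlinarith
  · rw [div_le_iff₀ hpos]
    have := norm_nonneg (f c)
    nlinarith [mul_le_mul_of_nonneg_right hc hpos.le, mul_nonneg this (by linarith : 0 ≤ R - t)]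

/-! ### The Riemann sphere in homogeneous coordinates -/

/-- The point of the Riemann sphere with homogeneous coordinates `w`. -/
def proj (w : ℂ × ℂ) : OnePoint ℂ :=
  if w.2 = 0 then OnePoint.infty else ((w.1 / w.2 : ℂ) : OnePoint ℂ)

theorem proj_of_ne {w : ℂ × ℂ} (h : w.2 ≠ 0) : proj w = ((w.1 / w.2 : ℂ) : OnePoint ℂ) :=
  if_neg h

theorem proj_smul {c : ℂ} (hc : c ≠ 0) (w : ℂ × ℂ) : proj (c • w) = proj w := by
  unfold proj
  by_cases h : w.2 = 0
  · simp [h]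
  · simp [h, hc, mul_div_mul_left]

theorem tendsto_proj_infty {ι : Type*} {l : Filter ι} {w : ι → ℂ × ℂ} (h0 : ∀ᶠ k in l, w k ≠ 0)
    (h : ∀ S : ℝ, 0 < S → ∀ᶠ k in l, S * ‖(w k).2‖ ≤ ‖(w k).1‖) :
    Tendsto (fun k => proj (w k)) l (𝓝 OnePoint.infty) := by
  refine (OnePoint.hasBasis_nhds_infty (X := ℂ)).tendsto_right_iff.2 fun K hK => ?_
  obtain ⟨S, hS⟩ := hK.2.isBounded.exists_norm_le
  filter_upwards [h0, h (|S| + 1) (by positivity)] with k hk0 hk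
  by_cases hz : (w k).2 = 0
  · right
    simp [proj, hz]
  · left
    rw [proj_of_ne hz]
    refine ⟨_, fun hmem => ?_, rfl⟩
    have h1 := hS _ hmem
    rw [norm_div, div_le_iff₀ (norm_pos_iff.2 hz)] at h1
    nlinarith [le_abs_self S, norm_pos_iff.2 hz]

theorem continuousAt_proj {w : ℂ × ℂ} (hw : w ≠ 0) : ContinuousAt proj w := by
  by_cases h : w.2 = 0
  · have h1 : w.1 ≠ 0 := fun h1 => hw (Prod.ext h1 h)
    have hp : proj w = OnePoint.infty := if_pos h
    rw [ContinuousAt, hp]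
    refine tendsto_proj_infty (w := id) (isOpen_ne.mem_nhds hw) fun S hS => ?_
    have hc1 : Tendsto (fun z : ℂ × ℂ => S * ‖z.2‖) (𝓝 w) (𝓝 (S * ‖w.2‖)) :=
      (by fun_prop : Continuous fun z : ℂ × ℂ => S * ‖z.2‖).tendsto w
    have hc2 : Tendsto (fun z : ℂ × ℂ => ‖z.1‖) (𝓝 w) (𝓝 ‖w.1‖) :=
      (by fun_prop : Continuous fun z : ℂ × ℂ => ‖z.1‖).tendsto w
    exact (hc1.eventually_lt hc2 (by simpa [h] using h1)).mono fun z hz => hz.le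
  · have h1 : ∀ᶠ z : ℂ × ℂ in 𝓝 w, ((z.1 / z.2 : ℂ) : OnePoint ℂ) = proj z :=
      (continuous_snd.continuousAt.eventually_ne h).mono fun z hz => (proj_of_ne hz).symm
    refine ContinuousAt.congr ?_ h1
    exact OnePoint.continuous_coe.continuousAt.comp
      (continuous_fst.continuousAt.div continuous_snd.continuousAt h)

theorem eventually_lt_of_tendsto_zero {ι : Type*} {l : Filter ι} {w : ι → ℂ × ℂ}
    (h : Tendsto (fun k => proj (w k)) l (𝓝 ((0 : ℂ) : OnePoint ℂ))) {r : ℝ} (hr : 0 < r) :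
    ∀ᶠ k in l, ‖(w k).1‖ < r * ‖(w k).2‖ := by
  have hmem : ((↑) : ℂ → OnePoint ℂ) '' Metric.ball 0 r ∈ 𝓝 ((0 : ℂ) : OnePoint ℂ) := by
    rw [OnePoint.nhds_coe_eq]
    exact image_mem_map (Metric.ball_mem_nhds 0 hr)
  filter_upwards [h hmem] with k hk
  obtain ⟨v, hv, hvk⟩ := hk
  by_cases hz : (w k).2 = 0
  · simp [proj, hz] at hvk
  · replace hvk : _ = proj (w k) := hvk
    rw [proj_of_ne hz] at hvk
    rw [OnePoint.coe_injective hvk, mem_ball_zero_iff, norm_div,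
      div_lt_iff₀ (norm_pos_iff.2 hz)] at hv
    exact hv

theorem eventually_lt_of_tendsto_infty {ι : Type*} {l : Filter ι} {w : ι → ℂ × ℂ}
    (h0 : ∀ k, w k ≠ 0) (h : Tendsto (fun k => proj (w k)) l (𝓝 OnePoint.infty)) {r : ℝ}
    (hr : 0 < r) : ∀ᶠ k in l, ‖(w k).2‖ < r * ‖(w k).1‖ := by
  have hK : IsCompact (Metric.closedBall (0 : ℂ) r⁻¹) := isCompact_closedBall _ _
  have := ((OnePoint.hasBasis_nhds_infty (X := ℂ)).tendsto_right_iff.1 h) _ ⟨hK.isClosed, hK⟩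
  filter_upwards [this] with k hk
  by_cases hz : (w k).2 = 0
  · have h1 : (w k).1 ≠ 0 := fun h1 => h0 k (Prod.ext h1 hz)
    rw [hz, norm_zero]
    have := norm_pos_iff.2 h1
    positivity
  · rw [proj_of_ne hz] at hk
    rcases hk with ⟨v, hv, hvk⟩ | hk
    · rw [OnePoint.coe_injective hvk, Set.mem_compl_iff, mem_closedBall_zero_iff, not_le, norm_div,
        lt_div_iff₀ (norm_pos_iff.2 hz)] at hv
      calc ‖(w k).2‖ = r * (r⁻¹ * ‖(w k).2‖) := by field_simp
        _ < r * ‖(w k).1‖ := by gcongr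
    · simp at hk

/-- Numerator and denominator have no common zero: where `q y + 2x = 0` the numerator reduces to
`x⁴`. -/
theorem liftMap_ne_zero {q : ℂ} (hq : q ≠ 0) {w : ℂ × ℂ} (hw : w ≠ 0) : liftMap q w ≠ 0 := by
  intro h
  have h1 : w.1 ^ 2 * (2 * q * w.2 ^ 2 + 4 * w.1 * w.2 + w.1 ^ 2) = 0 := congrArg Prod.fst h
  have h2 : w.2 ^ 2 * (q * w.2 + 2 * w.1) ^ 2 = 0 := congrArg Prod.snd h
  have key : w.1 = 0 ∧ w.2 = 0 := by
    rcases mul_eq_zero.1 h2 with h2 | h2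
    · have h3 : w.2 = 0 := by simpa using h2
      rw [h3] at h1
      exact ⟨by simpa using h1, h3⟩
    · have h3 : q * w.2 + 2 * w.1 = 0 := by simpa using h2
      have h4 : w.1 ^ 4 = 0 := by linear_combination h1 - 2 * w.1 ^ 2 * w.2 * h3
      have h5 : w.1 = 0 := by simpa using h4
      rw [h5] at h3
      exact ⟨h5, by simpa [hq] using h3⟩
  exact hw (Prod.ext key.1 key.2)

theorem F_proj (q : ℂ) (w : ℂ × ℂ) :
    F q (proj w) = proj (liftMap q w) := by
  by_cases h : w.2 = 0
  · have h1 : proj w = OnePoint.infty := if_pos h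
    have h2 : (liftMap q w).2 = 0 := by simp [liftMap, h]
    rw [h1, proj, if_pos h2]
    rfl
  · have h3 : q * w.2 + 2 * w.1 = (q + 2 * (w.1 / w.2)) * w.2 := by field_simp
    rw [proj_of_ne h]
    change (if q + 2 * (w.1 / w.2) = 0 then _ else _) = _
    by_cases h1 : q + 2 * (w.1 / w.2) = 0
    · have h2 : (liftMap q w).2 = 0 := by simp [liftMap, h3, h1]
      rw [if_pos h1, proj, if_pos h2]
    · have h2 : (liftMap q w).2 ≠ 0 := by
        simp [liftMap, h3, h1, h]
      rw [if_neg h1, proj_of_ne h2]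
      congr 1
      simp only [liftMap, h3]
      field_simp

theorem lift_ne_zero (v₀ : ℂ) {q : ℂ} (hq : q ≠ 0) (m : ℕ) : lift v₀ m q ≠ 0 := by
  induction m with
  | zero => simp [lift]
  | succ m ih =>
    rw [lift_succ]
    exact liftMap_ne_zero hq ih

theorem orbit_eq_proj (v₀ q : ℂ) (m : ℕ) :
    orbit v₀ m q = proj (lift v₀ m q) := by
  induction m with
  | zero => simp [orbit, lift, proj]
  | succ m ih =>
    rw [lift_succ, ← F_proj, ← ih]
    exact Function.iterate_succ_apply' _ _ _

theorem differentiable_lift (v₀ : ℂ) (m : ℕ) : Differentiable ℂ (lift v₀ m) := by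
  induction m with
  | zero => exact differentiable_const _
  | succ m ih =>
    have : lift v₀ (m + 1) = fun q => liftMap q (lift v₀ m q) := funext fun q => lift_succ v₀ m q
    rw [this]
    unfold liftMap
    fun_prop

theorem continuousOn_orbit (v₀ : ℂ) (m : ℕ) : ContinuousOn (orbit v₀ m) {0}ᶜ := by
  refine ContinuousOn.congr (f := fun q => proj (lift v₀ m q)) (fun q hq => ?_)
    fun q _ => orbit_eq_proj v₀ q m
  exact ((continuousAt_proj (lift_ne_zero v₀ hq m)).comp
    (differentiable_lift v₀ m).continuous.continuousAt).continuousWithinAt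

/-! ### Passivity and limits of orbits -/

/-- Joint convergence in index and point survives composition with `proj`, for which only continuity
at the limit vector is available. -/
theorem tendsto_prod_of_tendstoUniformlyOn {E : Type*} [NormedAddCommGroup E] {f : ℕ → ℂ → E}
    {g : ℂ → E} {s : Set ℂ} (h : TendstoUniformlyOn f g atTop s) (hg : ContinuousOn g s) {x : ℂ}
    (hx : s ∈ 𝓝 x) : Tendsto (fun y : ℕ × ℂ => f y.1 y.2) (atTop ×ˢ 𝓝 x) (𝓝 (g x)) := by
  rw [Metric.tendsto_nhds]
  intro ε hε
  have h1 := Metric.tendstoUniformlyOn_iff.1 h (ε / 2) (by positivity)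
  have h2 := Metric.tendsto_nhds.1 (hg.continuousAt hx) (ε / 2) (by positivity)
  filter_upwards [h1.prod_mk (h2.and hx)] with y hy
  have h3 := hy.1 y.2 hy.2.2
  rw [dist_comm] at h3
  linarith [dist_triangle (f y.1 y.2) (g y.2) (g x), hy.2.1]

open Metric in
/-- The marked point is passive where its orbit has holomorphic homogeneous coordinates that are
bounded and bounded away from zero. -/
theorem isPassive_of_bounded_lift {v₀ q₀ c : ℂ} {R C ε : ℝ} (hε : 0 < ε)
    {w : ℕ → ℂ → ℂ × ℂ} (hq₀ : q₀ ∈ ball c R) (h0 : (0 : ℂ) ∉ ball c R)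
    (hw : ∀ n, DifferentiableOn ℂ (w n) (ball c (2 * R)))
    (hC : ∀ n, ∀ z ∈ ball c (2 * R), ‖w n z‖ ≤ C)
    (hε' : ∀ n, ∀ z ∈ ball c R, ε ≤ ‖w n z‖)
    (horb : ∀ n, ∀ z ∈ ball c R, orbit v₀ n z = proj (w n z)) : IsPassive v₀ q₀ := by
  have hR : 0 < R := pos_of_mem_ball hq₀
  refine ⟨ball c R, isOpen_ball, hq₀, h0, fun s => ?_⟩
  obtain ⟨φ, hφ, g, hgc, hg⟩ := exists_subseq_tendstoUniformlyOn hR (fun n => hw (s n))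
    (fun n => hC (s n))
  refine ⟨φ, hφ, fun z => proj (g z), ?_⟩
  unfold SphereTendstoLocallyUniformlyOn
  let _ : UniformSpace (OnePoint ℂ) := uniformSpaceOfCompactR1
  rw [IsOpen.tendstoLocallyUniformlyOn_iff_forall_tendsto isOpen_ball]
  intro x hx
  have hnhds : closedBall c R ∈ 𝓝 x :=
    mem_of_superset (isOpen_ball.mem_nhds hx) ball_subset_closedBall
  have hx' : x ∈ closedBall c R := ball_subset_closedBall hx
  -- The lower bound passes to the limit, so `proj` is continuous at `g x`.
  have hgx : g x ≠ 0 := by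
    have h1 : ε ≤ ‖g x‖ := ge_of_tendsto (hg.tendsto_at hx').norm
      (Eventually.of_forall fun k => hε' _ x hx)
    exact norm_pos_iff.1 (hε.trans_le h1)
  have hp := (continuousAt_proj hgx).tendsto
  have h1 : Tendsto (fun y : ℕ × ℂ => proj (w (s (φ y.1)) y.2)) (atTop ×ˢ 𝓝 x)
      (𝓝 (proj (g x))) := hp.comp (tendsto_prod_of_tendstoUniformlyOn hg hgc hnhds)
  have h2 : Tendsto (fun y : ℕ × ℂ => proj (g y.2)) (atTop ×ˢ 𝓝 x) (𝓝 (proj (g x))) :=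
    (hp.comp (hgc.continuousAt hnhds)).comp tendsto_snd
  refine ((h2.prodMk_nhds h1).mono_right (nhds_le_uniformity _)).congr' ?_
  filter_upwards [tendsto_snd (isOpen_ball.mem_nhds hx)] with y hy
  rw [horb _ _ hy]

theorem continuousOn_limit {v₀ : ℂ} {s : ℕ → ℕ} {g : ℂ → OnePoint ℂ} {U : Set ℂ}
    (h0 : (0 : ℂ) ∉ U) (h : SphereTendstoLocallyUniformlyOn (fun k => orbit v₀ (s k)) g U) :
    ContinuousOn g U ∧ ∀ x ∈ U, Tendsto (fun k => orbit v₀ (s k) x) atTop (𝓝 (g x)) := by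
  unfold SphereTendstoLocallyUniformlyOn at h
  let _ : UniformSpace (OnePoint ℂ) := uniformSpaceOfCompactR1
  refine ⟨h.continuousOn (Frequently.of_forall fun k => (continuousOn_orbit v₀ _).mono ?_),
    fun x hx => h.tendsto_at hx⟩
  rintro x hx rfl
  exact h0 hx

/-- At a passive parameter in the closure of the set of parameters whose orbit tends to `p`, a
subsequence of the orbit tends to `p`. -/
theorem IsPassive.exists_tendsto {v₀ q₀ : ℂ} (h : IsPassive v₀ q₀) {p : OnePoint ℂ} {P : Set ℂ}
    (hP : ∀ q ∈ P, Tendsto (fun m => orbit v₀ m q) atTop (𝓝 p)) (hq₀ : q₀ ∈ closure P) :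
    ∃ t : ℕ → ℕ, Tendsto (fun k => orbit v₀ (t k) q₀) atTop (𝓝 p) := by
  obtain ⟨U, hU, hqU, h0, hn⟩ := h
  obtain ⟨t, ht, g, hg⟩ := hn id
  obtain ⟨hgc, hgt⟩ := continuousOn_limit h0 hg
  have hEq : ∀ x ∈ P ∩ U, g x = p := fun x hx =>
    tendsto_nhds_unique (hgt x hx.2) ((hP x hx.1).comp ht.tendsto_atTop)
  have hcl : q₀ ∈ closure (P ∩ U) := by
    rw [Set.inter_comm]
    exact hU.inter_closure ⟨hqU, hq₀⟩
  have : g q₀ = p := by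
    have h1 : (𝓝[P ∩ U] q₀).NeBot := mem_closure_iff_nhdsWithin_neBot.1 hcl
    have h2 : Tendsto g (𝓝[P ∩ U] q₀) (𝓝 (g q₀)) :=
      (hgc.continuousAt (hU.mem_nhds hqU)).tendsto.mono_left nhdsWithin_le_nhds
    refine tendsto_nhds_unique h2 (tendsto_const_nhds.congr' ?_)
    filter_upwards [self_mem_nhdsWithin] with x hx
    exact (hEq x hx).symm
  exact ⟨t, this ▸ hgt q₀ hqU⟩

/-! ### The superattracting points 0 and ∞ -/

/-- Near 0 the map behaves like `2v² / q`, so a small disc is contracted by any prescribed factor,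
uniformly for `q` near `q₀`. -/
theorem exists_contraction_zero {q₀ : ℂ} (hq₀ : q₀ ≠ 0) : ∃ r : ℝ, 0 < r ∧ ∀ᶠ q in 𝓝 q₀,
    ∀ w : ℂ × ℂ, ∀ s : ℝ, 0 ≤ s → s ≤ r → ‖w.1‖ ≤ s * ‖w.2‖ →
      ‖(liftMap q w).1‖ ≤ s / 2 * ‖(liftMap q w).2‖ := by
  set d := ‖q₀‖
  have hd : 0 < d := norm_pos_iff.2 hq₀
  -- For `d/2 < |q| < 2d`: `s ≤ 1` bounds the bracket in the numerator by `(4d + 5) b²`, `s ≤ d/8`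
  -- keeps `|q y + 2x| ≥ (d/4) b`, and the last bound yields the factor 1/2.
  refine ⟨min (min 1 (d / 8)) (d ^ 2 / (32 * (4 * d + 5))), by positivity, ?_⟩
  have h1 : ∀ᶠ q : ℂ in 𝓝 q₀, d / 2 < ‖q‖ :=
    continuous_norm.continuousAt.eventually_const_lt (by linarith)
  have h2 : ∀ᶠ q : ℂ in 𝓝 q₀, ‖q‖ < 2 * d :=
    continuous_norm.continuousAt.eventually_lt_const (by linarith)
  filter_upwards [h1, h2] with q hq1 hq2 w s hs0 hs hw
  have hs1 : s ≤ 1 := hs.trans ((min_le_left _ _).trans (min_le_left _ _))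
  have hs2 : s ≤ d / 8 := hs.trans ((min_le_left _ _).trans (min_le_right _ _))
  have hs3 : s * (32 * (4 * d + 5)) ≤ d ^ 2 :=
    (le_div_iff₀ (by positivity)).1 (hs.trans (min_le_right _ _))
  set a := ‖w.1‖
  set b := ‖w.2‖
  have ha : 0 ≤ a := norm_nonneg _
  have hb : 0 ≤ b := norm_nonneg _
  have hnum : ‖(liftMap q w).1‖ ≤ (s * b) ^ 2 * ((4 * d + 5) * b ^ 2) := by
    simp only [liftMap, norm_mul, norm_pow]
    have h3 : ‖2 * q * w.2 ^ 2 + 4 * w.1 * w.2 + w.1 ^ 2‖ ≤ (4 * d + 5) * b ^ 2 := by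
      calc ‖2 * q * w.2 ^ 2 + 4 * w.1 * w.2 + w.1 ^ 2‖
          ≤ ‖2 * q * w.2 ^ 2‖ + ‖4 * w.1 * w.2‖ + ‖w.1 ^ 2‖ := norm_add₃_le
        _ = 2 * ‖q‖ * b ^ 2 + 4 * a * b + a ^ 2 := by simp [a, b]
        _ ≤ 2 * (2 * d) * b ^ 2 + 4 * (1 * b) * b + (1 * b) ^ 2 := by
          have : a ≤ 1 * b := hw.trans (by gcongr)
          gcongr
        _ = (4 * d + 5) * b ^ 2 := by ring
    gcongr
  have hden : b ^ 2 * (d / 4 * b) ^ 2 ≤ ‖(liftMap q w).2‖ := by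
    simp only [liftMap, norm_mul, norm_pow]
    have h3 : d / 4 * b ≤ ‖q * w.2 + 2 * w.1‖ := by
      have h4 : ‖q * w.2‖ - ‖2 * w.1‖ ≤ ‖q * w.2 + 2 * w.1‖ := by
        simpa using norm_sub_norm_le (q * w.2) (-(2 * w.1))
      have h5 : ‖q * w.2‖ = ‖q‖ * b := norm_mul _ _
      have h6 : ‖2 * w.1‖ = 2 * a := by simp [a]
      have h7 : a ≤ d / 8 * b := hw.trans (by gcongr)
      nlinarith
    gcongr
  calc ‖(liftMap q w).1‖ ≤ (s * b) ^ 2 * ((4 * d + 5) * b ^ 2) := hnum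
    _ = s / 2 * (b ^ 4 * (s * (32 * (4 * d + 5)))) / 16 := by ring
    _ ≤ s / 2 * (b ^ 4 * d ^ 2) / 16 := by gcongr
    _ = s / 2 * (b ^ 2 * (d / 4 * b) ^ 2) := by ring
    _ ≤ s / 2 * ‖(liftMap q w).2‖ := by gcongr

/-- In the coordinate `y / x` the map is `4 (y / x)²` to leading order, whatever `q` is. -/
theorem exists_contraction_infty (q₀ : ℂ) : ∃ r : ℝ, 0 < r ∧ ∀ᶠ q in 𝓝 q₀,
    ∀ w : ℂ × ℂ, ∀ s : ℝ, 0 ≤ s → s ≤ r → ‖w.2‖ ≤ s * ‖w.1‖ →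
      ‖(liftMap q w).2‖ ≤ s / 2 * ‖(liftMap q w).1‖ := by
  set d := ‖q₀‖ + 1
  have hd : 1 ≤ d := by simp [d]
  -- This radius makes both `|y|` and `|q y|` at most `|x| / 32`.
  refine ⟨1 / (32 * d), by positivity, ?_⟩
  have h2 : ∀ᶠ q : ℂ in 𝓝 q₀, ‖q‖ < d :=
    continuous_norm.continuousAt.eventually_lt_const (by simp [d])
  filter_upwards [h2] with q hq2 w s hs0 hs hw
  have hs3 : s * (32 * d) ≤ 1 := (le_div_iff₀ (by positivity)).1 hs
  have hs1 : s ≤ 1 / 32 := by nlinarith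
  set a := ‖w.1‖
  set b := ‖w.2‖
  have ha : 0 ≤ a := norm_nonneg _
  have hb : 0 ≤ b := norm_nonneg _
  have hb' : b ≤ 1 / 32 * a := hw.trans (by gcongr)
  have hdb : d * b ≤ 1 / 32 * a := by
    calc d * b ≤ d * (s * a) := by gcongr
      _ = s * (32 * d) * a / 32 := by ring
      _ ≤ 1 * a / 32 := by gcongr
      _ = 1 / 32 * a := by ring
  have hden : ‖(liftMap q w).2‖ ≤ (s * a) * (1 / 32 * a) * (3 * a) ^ 2 := by
    simp only [liftMap, norm_mul, norm_pow]
    have h3 : ‖q * w.2 + 2 * w.1‖ ≤ 3 * a := by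
      calc ‖q * w.2 + 2 * w.1‖ ≤ ‖q * w.2‖ + ‖2 * w.1‖ := norm_add_le _ _
        _ = ‖q‖ * b + 2 * a := by simp [a, b]
        _ ≤ d * b + 2 * a := by gcongr
        _ ≤ 3 * a := by linarith
    rw [pow_two ‖w.2‖]
    gcongr
  have hnum : a ^ 2 * (3 / 4 * a ^ 2) ≤ ‖(liftMap q w).1‖ := by
    simp only [liftMap, norm_mul, norm_pow]
    have h3 : 3 / 4 * a ^ 2 ≤ ‖2 * q * w.2 ^ 2 + 4 * w.1 * w.2 + w.1 ^ 2‖ := by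
      have h4 : ‖w.1 ^ 2‖ - ‖2 * q * w.2 ^ 2 + 4 * w.1 * w.2‖ ≤
          ‖2 * q * w.2 ^ 2 + 4 * w.1 * w.2 + w.1 ^ 2‖ := by
        rw [add_comm (2 * q * w.2 ^ 2 + 4 * w.1 * w.2)]
        simpa only [sub_neg_eq_add, norm_neg] using
          norm_sub_norm_le (w.1 ^ 2) (-(2 * q * w.2 ^ 2 + 4 * w.1 * w.2))
      have h5 : ‖2 * q * w.2 ^ 2 + 4 * w.1 * w.2‖ ≤ 2 * (1 / 32 * a) * (1 / 32 * a) +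
          4 * a * (1 / 32 * a) := by
        calc ‖2 * q * w.2 ^ 2 + 4 * w.1 * w.2‖ ≤ ‖2 * q * w.2 ^ 2‖ + ‖4 * w.1 * w.2‖ :=
              norm_add_le _ _
          _ = 2 * (‖q‖ * b) * b + 4 * a * b := by simp [a, b]; ring
          _ ≤ 2 * (d * b) * b + 4 * a * b := by gcongr
          _ ≤ _ := by gcongr
      have h6 : ‖w.1 ^ 2‖ = a ^ 2 := norm_pow _ _
      nlinarith [sq_nonneg a]
    gcongr
  calc ‖(liftMap q w).2‖ ≤ (s * a) * (1 / 32 * a) * (3 * a) ^ 2 := hden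
    _ = s / 2 * (a ^ 4 * (9 / 16)) := by ring
    _ ≤ s / 2 * (a ^ 4 * (3 / 4)) :=
      mul_le_mul_of_nonneg_left
        (mul_le_mul_of_nonneg_left (by norm_num) (by positivity)) (by positivity)
    _ = s / 2 * (a ^ 2 * (3 / 4 * a ^ 2)) := by ring
    _ ≤ s / 2 * ‖(liftMap q w).1‖ := by gcongr

theorem tendsto_geometric_mul (r : ℝ) : Tendsto (fun k : ℕ => r / 2 ^ k) atTop (𝓝 0) := by
  have := (tendsto_pow_atTop_nhds_zero_of_lt_one (r := (1 / 2 : ℝ)) (by norm_num)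
    (by norm_num)).const_mul r
  simpa [div_eq_mul_inv] using this

theorem exists_trap_zero (v₀ : ℂ) {q₀ : ℂ} (hq₀ : q₀ ≠ 0) : ∃ r : ℝ, 0 < r ∧ ∀ᶠ q in 𝓝 q₀,
    q ≠ 0 ∧ ∀ m, ‖(lift v₀ m q).1‖ ≤ r * ‖(lift v₀ m q).2‖ →
      ∀ k, ‖(lift v₀ (m + k) q).1‖ ≤ r / 2 ^ k * ‖(lift v₀ (m + k) q).2‖ := by
  obtain ⟨r, hr, h⟩ := exists_contraction_zero hq₀
  refine ⟨r, hr, ?_⟩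
  filter_upwards [h, isOpen_ne.mem_nhds hq₀] with q hq hq0
  refine ⟨hq0, fun m hm k => ?_⟩
  induction k with
  | zero => simpa using hm
  | succ k ih =>
    rw [← add_assoc, lift_succ, pow_succ, ← div_div]
    exact hq _ _ (by positivity) (div_le_self hr.le (one_le_pow₀ (by norm_num))) ih

theorem exists_trap_infty (v₀ q₀ : ℂ) : ∃ r : ℝ, 0 < r ∧ ∀ᶠ q in 𝓝 q₀,
    ∀ m, ‖(lift v₀ m q).2‖ ≤ r * ‖(lift v₀ m q).1‖ →
      ∀ k, ‖(lift v₀ (m + k) q).2‖ ≤ r / 2 ^ k * ‖(lift v₀ (m + k) q).1‖ := by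
  obtain ⟨r, hr, h⟩ := exists_contraction_infty q₀
  refine ⟨r, hr, ?_⟩
  filter_upwards [h] with q hq m hm k
  induction k with
  | zero => simpa using hm
  | succ k ih =>
    rw [← add_assoc, lift_succ, pow_succ, ← div_div]
    exact hq _ _ (by positivity) (div_le_self hr.le (one_le_pow₀ (by norm_num))) ih

theorem mem_P0_of_trap {v₀ q : ℂ} (hq : q ≠ 0) {r : ℝ} {m : ℕ}
    (h : ∀ k, ‖(lift v₀ (m + k) q).1‖ ≤ r / 2 ^ k * ‖(lift v₀ (m + k) q).2‖) : q ∈ P0 v₀ := by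
  refine ⟨hq, (tendsto_add_atTop_iff_nat m).1 ?_⟩
  have hne : ∀ k, (lift v₀ (k + m) q).2 ≠ 0 := by
    intro k h2
    have h1 := h k
    rw [add_comm, h2, norm_zero, mul_zero, norm_le_zero_iff] at h1
    exact lift_ne_zero v₀ hq _ (Prod.ext h1 h2)
  have : ∀ k, orbit v₀ (k + m) q =
      (((lift v₀ (k + m) q).1 / (lift v₀ (k + m) q).2 : ℂ) : OnePoint ℂ) := fun k => by
    rw [orbit_eq_proj, proj_of_ne (hne k)]
  simp_rw [this]
  refine (OnePoint.continuous_coe.tendsto 0).comp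
    (squeeze_zero_norm (fun k => ?_) (tendsto_geometric_mul r))
  rw [norm_div, div_le_iff₀ (norm_pos_iff.2 (hne k)), add_comm k m]
  exact h k

theorem mem_PInfty_of_trap {v₀ q : ℂ} (hq : q ≠ 0) {r : ℝ} {m : ℕ}
    (h : ∀ k, ‖(lift v₀ (m + k) q).2‖ ≤ r / 2 ^ k * ‖(lift v₀ (m + k) q).1‖) :
    q ∈ PInfty v₀ := by
  refine ⟨hq, (tendsto_add_atTop_iff_nat m).1 ?_⟩
  simp_rw [orbit_eq_proj]
  refine tendsto_proj_infty (Eventually.of_forall fun k => lift_ne_zero v₀ hq _) fun S hS => ?_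
  filter_upwards [(tendsto_geometric_mul r).eventually_le_const (inv_pos.2 hS)] with k hk
  rw [add_comm k m]
  calc S * ‖(lift v₀ (m + k) q).2‖ ≤ S * (S⁻¹ * ‖(lift v₀ (m + k) q).1‖) := by
        have := (h k).trans (mul_le_mul_of_nonneg_right hk (norm_nonneg _))
        gcongr
    _ = _ := by field_simp

/-- Entering the trap at time `m` is a strict inequality between continuous functions of `q`, so
nearby parameters enter at the same time. -/
theorem eventually_trap_of_mem_P0 {v₀ q₀ : ℂ} (h : q₀ ∈ P0 v₀) : ∃ r : ℝ, ∃ m, ∀ᶠ q in 𝓝 q₀,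
    q ≠ 0 ∧ ∀ k, ‖(lift v₀ (m + k) q).1‖ ≤ r / 2 ^ k * ‖(lift v₀ (m + k) q).2‖ := by
  obtain ⟨r, hr, hq⟩ := exists_trap_zero v₀ h.1
  have h1 := h.2
  simp_rw [orbit_eq_proj] at h1
  obtain ⟨m, hm⟩ := (eventually_lt_of_tendsto_zero h1 hr).exists
  have hc := (differentiable_lift v₀ m).continuous
  have h2 := ContinuousAt.eventually_lt (f := fun q => ‖(lift v₀ m q).1‖)
    (g := fun q => r * ‖(lift v₀ m q).2‖) (by fun_prop) (by fun_prop) hm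
  refine ⟨r, m, ?_⟩
  filter_upwards [hq, h2] with q hq hq2
  exact ⟨hq.1, hq.2 m hq2.le⟩

theorem eventually_trap_of_mem_PInfty {v₀ q₀ : ℂ} (h : q₀ ∈ PInfty v₀) :
    ∃ r : ℝ, ∃ m, ∀ᶠ q in 𝓝 q₀,
      q ≠ 0 ∧ ∀ k, ‖(lift v₀ (m + k) q).2‖ ≤ r / 2 ^ k * ‖(lift v₀ (m + k) q).1‖ := by
  obtain ⟨r, hr, hq⟩ := exists_trap_infty v₀ q₀
  have h1 := h.2
  simp_rw [orbit_eq_proj] at h1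
  obtain ⟨m, hm⟩ := (eventually_lt_of_tendsto_infty (fun k => lift_ne_zero v₀ h.1 k) h1 hr).exists
  have hc := (differentiable_lift v₀ m).continuous
  have h2 := ContinuousAt.eventually_lt (f := fun q => ‖(lift v₀ m q).2‖)
    (g := fun q => r * ‖(lift v₀ m q).1‖) (by fun_prop) (by fun_prop) hm
  refine ⟨r, m, ?_⟩
  filter_upwards [hq, h2, isOpen_ne.mem_nhds h.1] with q hq hq2 hq0
  exact ⟨hq0, hq m hq2.le⟩

theorem isOpen_P0 (v₀ : ℂ) : IsOpen (P0 v₀) := by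
  rw [isOpen_iff_mem_nhds]
  intro q₀ h
  obtain ⟨r, m, hrm⟩ := eventually_trap_of_mem_P0 h
  exact hrm.mono fun q hq => mem_P0_of_trap hq.1 hq.2

theorem isOpen_PInfty (v₀ : ℂ) : IsOpen (PInfty v₀) := by
  rw [isOpen_iff_mem_nhds]
  intro q₀ h
  obtain ⟨r, m, hrm⟩ := eventually_trap_of_mem_PInfty h
  exact hrm.mono fun q hq => mem_PInfty_of_trap hq.1 hq.2

theorem disjoint_P0_PInfty (v₀ : ℂ) : Disjoint (P0 v₀) (PInfty v₀) := by
  rw [Set.disjoint_left]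
  intro q h1 h2
  exact OnePoint.coe_ne_infty _ (tendsto_nhds_unique h1.2 h2.2)

/-! ### The basin boundaries and the active locus -/

/-- A subsequence tending to 0 suffices: one visit to the trap forces convergence of the whole
orbit. -/
theorem mem_P0_of_isPassive {v₀ q₀ : ℂ} (hq₀ : q₀ ≠ 0) (h : IsPassive v₀ q₀)
    (hcl : q₀ ∈ closure (P0 v₀)) : q₀ ∈ P0 v₀ := by
  obtain ⟨t, ht⟩ := h.exists_tendsto (fun q hq => hq.2) hcl
  simp_rw [orbit_eq_proj] at ht
  obtain ⟨r, hr, hq⟩ := exists_trap_zero v₀ hq₀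
  obtain ⟨k, hk⟩ := (eventually_lt_of_tendsto_zero ht hr).exists
  exact mem_P0_of_trap hq₀ (hq.self_of_nhds.2 _ hk.le)

theorem mem_PInfty_of_isPassive {v₀ q₀ : ℂ} (hq₀ : q₀ ≠ 0) (h : IsPassive v₀ q₀)
    (hcl : q₀ ∈ closure (PInfty v₀)) : q₀ ∈ PInfty v₀ := by
  obtain ⟨t, ht⟩ := h.exists_tendsto (fun q hq => hq.2) hcl
  simp_rw [orbit_eq_proj] at ht
  obtain ⟨r, hr, hq⟩ := exists_trap_infty v₀ q₀
  obtain ⟨k, hk⟩ := (eventually_lt_of_tendsto_infty (fun k => lift_ne_zero v₀ hq₀ _) ht hr).exists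
  exact mem_PInfty_of_trap hq₀ (hq.self_of_nhds _ hk.le)

theorem exists_ball_two_mul {p : ℂ → Prop} {q₀ : ℂ} (h : ∀ᶠ q in 𝓝 q₀, p q) :
    ∃ R : ℝ, 0 < R ∧ ∀ q ∈ Metric.ball q₀ (2 * R), p q := by
  obtain ⟨ε, hε, hp⟩ := Metric.eventually_nhds_iff_ball.1 h
  exact ⟨ε / 2, by positivity, by rwa [mul_div_cancel₀ ε two_ne_zero]⟩

/-- Nearby orbits never enter the trap around 0, so `1 / v` stays bounded and Montel's theorem
applies in that chart. -/
theorem isPassive_of_notMem_closure_P0 {v₀ q₀ : ℂ} (hq₀ : q₀ ≠ 0) (h : q₀ ∉ closure (P0 v₀)) :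
    IsPassive v₀ q₀ := by
  obtain ⟨r, hr, hq⟩ := exists_trap_zero v₀ hq₀
  obtain ⟨R, hR, hball⟩ := exists_ball_two_mul
    (hq.and (isClosed_closure.isOpen_compl.mem_nhds h))
  have hlt : ∀ n, ∀ z ∈ Metric.ball q₀ (2 * R), r * ‖(lift v₀ n z).2‖ < ‖(lift v₀ n z).1‖ := by
    intro n z hz
    by_contra! hle
    exact (hball z hz).2 (subset_closure
      (mem_P0_of_trap (hball z hz).1.1 ((hball z hz).1.2 n hle)))
  have hne : ∀ n, ∀ z ∈ Metric.ball q₀ (2 * R), (lift v₀ n z).1 ≠ 0 := fun n z hz =>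
    norm_pos_iff.1 (lt_of_le_of_lt (by positivity) (hlt n z hz))
  have hsub := Metric.ball_subset_ball (x := q₀) (by linarith : R ≤ 2 * R)
  refine isPassive_of_bounded_lift (C := max 1 r⁻¹) one_pos
    (w := fun n z => (1, (lift v₀ n z).2 / (lift v₀ n z).1)) (Metric.mem_ball_self hR)
    (fun h0 => (hball 0 (hsub h0)).1.1 rfl) ?_ ?_ ?_ ?_
  · intro n
    have hd := differentiable_lift v₀ n
    exact (differentiableOn_const _).prodMk
      (hd.snd.differentiableOn.div hd.fst.differentiableOn (hne n))
  · intro n z hz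
    rw [Prod.norm_def]
    refine max_le_max (by simp) ?_
    rw [norm_div, div_le_iff₀ (norm_pos_iff.2 (hne n z hz)), ← div_eq_inv_mul, le_div_iff₀ hr,
      mul_comm]
    exact (hlt n z hz).le
  · intro n z hz
    rw [Prod.norm_def]
    exact le_max_of_le_left (by simp)
  · intro n z hz
    have hz' := hsub hz
    have hz1 := hne n z hz'
    rw [orbit_eq_proj, ← proj_smul (inv_ne_zero hz1)]
    congr 1
    ext
    · simp [hz1]
    · simp [div_eq_inv_mul]

theorem isPassive_of_notMem_closure_PInfty {v₀ q₀ : ℂ} (hq₀ : q₀ ≠ 0)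
    (h : q₀ ∉ closure (PInfty v₀)) : IsPassive v₀ q₀ := by
  obtain ⟨r, hr, hq⟩ := exists_trap_infty v₀ q₀
  obtain ⟨R, hR, hball⟩ := exists_ball_two_mul
    ((hq.and (isOpen_ne.mem_nhds hq₀)).and (isClosed_closure.isOpen_compl.mem_nhds h))
  have hlt : ∀ n, ∀ z ∈ Metric.ball q₀ (2 * R), r * ‖(lift v₀ n z).1‖ < ‖(lift v₀ n z).2‖ := by
    intro n z hz
    by_contra! hle
    exact (hball z hz).2 (subset_closure
      (mem_PInfty_of_trap (hball z hz).1.2 ((hball z hz).1.1 n hle)))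
  have hne : ∀ n, ∀ z ∈ Metric.ball q₀ (2 * R), (lift v₀ n z).2 ≠ 0 := fun n z hz =>
    norm_pos_iff.1 (lt_of_le_of_lt (by positivity) (hlt n z hz))
  have hsub := Metric.ball_subset_ball (x := q₀) (by linarith : R ≤ 2 * R)
  refine isPassive_of_bounded_lift (C := max r⁻¹ 1) one_pos
    (w := fun n z => ((lift v₀ n z).1 / (lift v₀ n z).2, 1)) (Metric.mem_ball_self hR)
    (fun h0 => (hball 0 (hsub h0)).1.2 rfl) ?_ ?_ ?_ ?_
  · intro n
    have hd := differentiable_lift v₀ n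
    exact (hd.fst.differentiableOn.div hd.snd.differentiableOn (hne n)).prodMk
      (differentiableOn_const _)
  · intro n z hz
    rw [Prod.norm_def]
    refine max_le_max ?_ (by simp)
    rw [norm_div, div_le_iff₀ (norm_pos_iff.2 (hne n z hz)), ← div_eq_inv_mul, le_div_iff₀ hr,
      mul_comm]
    exact (hlt n z hz).le
  · intro n z hz
    rw [Prod.norm_def]
    exact le_max_of_le_right (by simp)
  · intro n z hz
    have hz' := hsub hz
    have hz1 := hne n z hz'
    rw [orbit_eq_proj, ← proj_smul (inv_ne_zero hz1)]
    congr 1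
    ext
    · simp [div_eq_inv_mul]
    · simp [hz1]

/-- An active point is not in the open set `P0`: it would lie off the closure of the disjoint set
`PInfty`, where every parameter is passive. -/
theorem frontier_P0_inter (v₀ : ℂ) : frontier (P0 v₀) ∩ {0}ᶜ = A v₀ := by
  rw [(isOpen_P0 v₀).frontier_eq]
  ext q
  constructor
  · rintro ⟨⟨h1, h2⟩, hq⟩
    exact ⟨hq, fun h => h2 (mem_P0_of_isPassive hq h h1)⟩
  · rintro ⟨hq, h⟩
    refine ⟨⟨by_contra fun h1 => h (isPassive_of_notMem_closure_P0 hq h1), fun h1 => ?_⟩, hq⟩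
    exact h (isPassive_of_notMem_closure_PInfty hq
      ((disjoint_P0_PInfty v₀).closure_right (isOpen_P0 v₀) |>.notMem_of_mem_left h1))

theorem frontier_PInfty_inter (v₀ : ℂ) : frontier (PInfty v₀) ∩ {0}ᶜ = A v₀ := by
  rw [(isOpen_PInfty v₀).frontier_eq]
  ext q
  constructor
  · rintro ⟨⟨h1, h2⟩, hq⟩
    exact ⟨hq, fun h => h2 (mem_PInfty_of_isPassive hq h h1)⟩
  · rintro ⟨hq, h⟩
    refine ⟨⟨by_contra fun h1 => h (isPassive_of_notMem_closure_PInfty hq h1), fun h1 => ?_⟩, hq⟩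
    exact h (isPassive_of_notMem_closure_P0 hq
      ((disjoint_P0_PInfty v₀).symm.closure_right (isOpen_PInfty v₀) |>.notMem_of_mem_left h1))

/-! ### The escape rate and the zeros near active parameters -/

theorem liftMap_smul (q c : ℂ) (w : ℂ × ℂ) : liftMap q (c • w) = c ^ 4 • liftMap q w := by
  ext <;> simp only [liftMap, Prod.smul_fst, Prod.smul_snd, smul_eq_mul] <;> ring

/-- The linear form whose vanishing says that the point with homogeneous coordinates `w` is `-q`. -/
def zeroForm (q : ℂ) (w : ℂ × ℂ) : ℂ := q * w.2 + w.1

theorem zeroForm_smul (q c : ℂ) (w : ℂ × ℂ) : zeroForm q (c • w) = c * zeroForm q w := by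
  simp only [zeroForm, Prod.smul_fst, Prod.smul_snd, smul_eq_mul]
  ring

theorem Z_eq_zeroForm (m : ℕ) (q v₀ : ℂ) : Z m q v₀ = q * zeroForm q (lift v₀ m q) :=
  Z_eq m q v₀

theorem exists_smul_of_ne_zero {w : ℂ × ℂ} (hw : w ≠ 0) :
    ∃ w' : ℂ × ℂ, ‖w'‖ = 1 ∧ w = (‖w‖ : ℂ) • w' := by
  have h : (‖w‖ : ℂ) ≠ 0 := by simpa using hw
  refine ⟨(‖w‖ : ℂ)⁻¹ • w, ?_, by rw [smul_inv_smul₀ h]⟩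
  rw [norm_smul, norm_inv, Complex.norm_real, norm_norm, inv_mul_cancel₀ (norm_ne_zero_iff.2 hw)]

theorem continuous_liftMap : Continuous fun p : ℂ × (ℂ × ℂ) => liftMap p.1 p.2 := by
  unfold liftMap
  fun_prop

theorem continuous_zeroForm : Continuous fun p : ℂ × (ℂ × ℂ) => zeroForm p.1 p.2 := by
  unfold zeroForm
  fun_prop

/-- Homogeneity reduces both bounds to the unit sphere, where `liftMap` does not vanish and
compactness applies. -/
theorem exists_norm_liftMap_bounds {K : Set ℂ} (hK : IsCompact K) (h0 : (0 : ℂ) ∉ K) :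
    ∃ C : ℝ, 1 ≤ C ∧ ∀ q ∈ K, ∀ w : ℂ × ℂ,
      C⁻¹ * ‖w‖ ^ 4 ≤ ‖liftMap q w‖ ∧ ‖liftMap q w‖ ≤ C * ‖w‖ ^ 4 := by
  have hS : IsCompact (K ×ˢ Metric.sphere (0 : ℂ × ℂ) 1) := hK.prod (isCompact_sphere _ _)
  have hc : ContinuousOn (fun p : ℂ × (ℂ × ℂ) => ‖liftMap p.1 p.2‖)
      (K ×ˢ Metric.sphere (0 : ℂ × ℂ) 1) := continuous_liftMap.norm.continuousOn
  obtain ⟨a, ha, hlow⟩ := hS.exists_forall_le' (a := 0) hc (by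
    rintro ⟨q, w⟩ ⟨hq, hw⟩
    refine norm_pos_iff.2 (liftMap_ne_zero (fun h => h0 (h ▸ hq)) ?_)
    rintro rfl
    simp at hw)
  obtain ⟨b, hb⟩ := hS.exists_bound_of_continuousOn hc
  refine ⟨max 1 (max a⁻¹ b), le_max_left _ _, fun q hq w => ?_⟩
  by_cases hw : w = 0
  · simp [hw, liftMap]
  obtain ⟨w', hw', hww⟩ := exists_smul_of_ne_zero hw
  have hmem : (q, w') ∈ K ×ˢ Metric.sphere (0 : ℂ × ℂ) 1 := ⟨hq, by simpa using hw'⟩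
  have h1 : ‖liftMap q w‖ = ‖w‖ ^ 4 * ‖liftMap q w'‖ := by
    conv_lhs => rw [hww, liftMap_smul, norm_smul, norm_pow, Complex.norm_real, norm_norm]
  have h2 := hlow _ hmem
  have h3 := hb _ hmem
  rw [norm_norm] at h3
  rw [h1, mul_comm _ (‖w‖ ^ 4), mul_comm _ (‖w‖ ^ 4)]
  constructor
  · refine mul_le_mul_of_nonneg_left (le_trans ?_ h2) (by positivity)
    exact inv_le_of_inv_le₀ ha ((le_max_left _ _).trans (le_max_right _ _))
  · exact mul_le_mul_of_nonneg_left (h3.trans ((le_max_right _ _).trans (le_max_right _ _)))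
      (by positivity)

/-- If `w` represents `-q` and `q ≠ 0, 1`, then its image does not. -/
theorem exists_le_max_norm_zeroForm {K : Set ℂ} (hK : IsCompact K) (h0 : (0 : ℂ) ∉ K)
    (h1 : (1 : ℂ) ∉ K) : ∃ ε : ℝ, 0 < ε ∧ ∀ q ∈ K, ∀ w : ℂ × ℂ,
      ε * ‖w‖ ≤ ‖zeroForm q w‖ ∨ ε * ‖liftMap q w‖ ≤ ‖zeroForm q (liftMap q w)‖ := by
  obtain ⟨C, hC, hCb⟩ := exists_norm_liftMap_bounds hK h0
  have hS : IsCompact (K ×ˢ Metric.sphere (0 : ℂ × ℂ) 1) := hK.prod (isCompact_sphere _ _)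
  have hc : Continuous (fun p : ℂ × (ℂ × ℂ) =>
      max ‖zeroForm p.1 p.2‖ ‖zeroForm p.1 (liftMap p.1 p.2)‖) :=
    continuous_zeroForm.norm.max
      (continuous_zeroForm.comp (continuous_fst.prodMk continuous_liftMap)).norm
  obtain ⟨a, ha, hlow⟩ := hS.exists_forall_le' (a := 0) hc.continuousOn (by
    rintro ⟨q, w⟩ ⟨hq, hw⟩
    have hw0 : w ≠ 0 := by
      rintro rfl
      simp at hw
    have hq0 : q ≠ 0 := fun h => h0 (h ▸ hq)
    have hq1 : q - 1 ≠ 0 := fun h => h1 (sub_eq_zero.1 h ▸ hq)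
    rw [lt_max_iff, norm_pos_iff, norm_pos_iff]
    by_contra! h
    obtain ⟨h2, h3⟩ := h
    simp only [zeroForm, liftMap] at h2 h3
    have h4 : w.1 = -(q * w.2) := by linear_combination h2
    rw [h4] at h3
    -- The factor `q - 1` is where the exclusion of `q = 1` enters: there `-q` is a fixed point.
    have h5 : w.2 ^ 4 * q ^ 3 * (q - 1) = 0 := by linear_combination h3
    have h6 : w.2 = 0 := by simpa [hq0, hq1] using h5
    exact hw0 (Prod.ext (by simp [h4, h6]) h6))
  refine ⟨a / C, by positivity, fun q hq w => ?_⟩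
  by_cases hw : w = 0
  · simp [hw]
  obtain ⟨w', hw', hww⟩ := exists_smul_of_ne_zero hw
  have hmem : (q, w') ∈ K ×ˢ Metric.sphere (0 : ℂ × ℂ) 1 := ⟨hq, by simpa using hw'⟩
  have h2 := hlow _ hmem
  rcases le_max_iff.1 h2 with h2 | h2
  · left
    rw [hww, zeroForm_smul, norm_smul, norm_mul, hw', Complex.norm_real, norm_norm, mul_one,
      mul_comm]
    gcongr
    exact (div_le_self ha.le hC).trans h2
  · right
    have h3 := (hCb q hq w').2
    rw [hw', one_pow, mul_one] at h3
    rw [hww, liftMap_smul, zeroForm_smul, norm_smul, norm_mul, mul_left_comm]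
    gcongr
    calc a / C * ‖liftMap q w'‖ ≤ a / C * C := by gcongr
      _ = a := by field_simp
      _ ≤ _ := h2

/-- The escape rate of the lifted orbit. -/
theorem exists_escape_rate (v₀ : ℂ) {K : Set ℂ} (hK : IsCompact K) (h0 : (0 : ℂ) ∉ K) :
    ∃ G : ℂ → ℝ, ∃ L : ℝ, ∀ q ∈ K, ∀ m,
      |(1 / 4) ^ m * Real.log ‖lift v₀ m q‖ - G q| ≤ L * (1 / 4) ^ m := by
  obtain ⟨C, hC, hCb⟩ := exists_norm_liftMap_bounds hK h0
  -- `log ‖lift‖` is multiplied by 4 at each step up to an error `log C`, so the normalized sequence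
  -- is Cauchy with geometric rate.
  have hstep : ∀ q ∈ K, ∀ m, dist ((1 / 4 : ℝ) ^ m * Real.log ‖lift v₀ m q‖)
      ((1 / 4) ^ (m + 1) * Real.log ‖lift v₀ (m + 1) q‖) ≤ Real.log C * (1 / 4) ^ m := by
    intro q hq m
    have hne := norm_pos_iff.2 (lift_ne_zero v₀ (fun h => h0 (h ▸ hq)) m)
    have hb := hCb q hq (lift v₀ m q)
    rw [← lift_succ] at hb
    have hC0 : 0 < C := by linarith
    have hpos : 0 < C⁻¹ * ‖lift v₀ m q‖ ^ 4 := by positivity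
    have h1 := Real.log_le_log hpos hb.1
    have h2 := Real.log_le_log (hpos.trans_le hb.1) hb.2
    rw [Real.log_mul (by positivity) (by positivity), Real.log_pow, Real.log_inv] at h1
    rw [Real.log_mul (by positivity) (by positivity), Real.log_pow] at h2
    push_cast at h1 h2
    have h3 : 0 ≤ Real.log C := Real.log_nonneg hC
    have h4 : |Real.log ‖lift v₀ (m + 1) q‖ - 4 * Real.log ‖lift v₀ m q‖| ≤ 4 * Real.log C := by
      rw [abs_le]
      constructor <;> linarith
    rw [dist_comm, Real.dist_eq]
    calc |(1 / 4) ^ (m + 1) * Real.log ‖lift v₀ (m + 1) q‖ - (1 / 4) ^ m * Real.log ‖lift v₀ m q‖|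
        = (1 / 4) ^ (m + 1) * |Real.log ‖lift v₀ (m + 1) q‖ - 4 * Real.log ‖lift v₀ m q‖| := by
          rw [← abs_of_pos (show (0 : ℝ) < (1 / 4) ^ (m + 1) by positivity), ← abs_mul,
            abs_of_pos (show (0 : ℝ) < (1 / 4) ^ (m + 1) by positivity)]
          ring_nf
      _ ≤ (1 / 4) ^ (m + 1) * (4 * Real.log C) := by gcongr
      _ = Real.log C * (1 / 4) ^ m := by ring
  have hlim : ∀ q, ∃ g : ℝ, q ∈ K → Tendsto
      (fun m => (1 / 4 : ℝ) ^ m * Real.log ‖lift v₀ m q‖) atTop (𝓝 g) := by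
    intro q
    by_cases hq : q ∈ K
    · obtain ⟨g, hg⟩ := cauchySeq_tendsto_of_complete
        (cauchySeq_of_le_geometric _ _ (by norm_num) (hstep q hq))
      exact ⟨g, fun _ => hg⟩
    · exact ⟨0, fun h => absurd h hq⟩
  choose G hG using hlim
  refine ⟨G, Real.log C / (1 - 1 / 4), fun q hq m => ?_⟩
  have := dist_le_of_le_geometric_of_tendsto _ _ (by norm_num) (hstep q hq) (hG q hq) m
  rw [Real.dist_eq] at this
  rwa [div_mul_eq_mul_div]

/-- The normalized logarithm of the size of the linear form whose zeros are counted. -/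
def zeroRate (v₀ : ℂ) (m : ℕ) (q : ℂ) : ℝ :=
  (1 / 4) ^ m * Real.log ‖zeroForm q (lift v₀ m q)‖

theorem zeroRate_ge {G L ε : ℝ} {v q : ℂ} {m : ℕ} (hq : q ≠ 0) (hε : 0 < ε)
    (hG : |(1 / 4) ^ m * Real.log ‖lift v m q‖ - G| ≤ L * (1 / 4) ^ m)
    (h : ε * ‖lift v m q‖ ≤ ‖zeroForm q (lift v m q)‖) :
    G - (L - Real.log ε) * (1 / 4) ^ m ≤ zeroRate v m q := by
  have hne := norm_pos_iff.2 (lift_ne_zero v hq m)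
  have h1 := Real.log_le_log (by positivity) h
  rw [Real.log_mul hε.ne' hne.ne'] at h1
  have h2 := mul_le_mul_of_nonneg_left h1 (show (0 : ℝ) ≤ (1 / 4) ^ m by positivity)
  unfold zeroRate
  linarith [(abs_le.1 hG).1]

/-- Nonvanishing is needed because `Real.log 0 = 0`, not `-∞`. -/
theorem zeroRate_le {G L B : ℝ} {v q : ℂ} {m : ℕ} (hq : q ≠ 0) (hB : ‖q‖ ≤ B)
    (hG : |(1 / 4) ^ m * Real.log ‖lift v m q‖ - G| ≤ L * (1 / 4) ^ m)
    (h : zeroForm q (lift v m q) ≠ 0) :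
    zeroRate v m q ≤ G + (L + Real.log (B + 1)) * (1 / 4) ^ m := by
  have hne := norm_pos_iff.2 (lift_ne_zero v hq m)
  have hB0 : 0 ≤ B := (norm_nonneg q).trans hB
  have h0 : ‖zeroForm q (lift v m q)‖ ≤ (B + 1) * ‖lift v m q‖ := by
    calc ‖zeroForm q (lift v m q)‖ ≤ ‖q‖ * ‖(lift v m q).2‖ + ‖(lift v m q).1‖ := by
          rw [← norm_mul]
          exact norm_add_le _ _
      _ ≤ B * ‖lift v m q‖ + ‖lift v m q‖ := by
          gcongr
          · exact norm_snd_le _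
          · exact norm_fst_le _
      _ = _ := by ring
  have h1 := Real.log_le_log (norm_pos_iff.2 h) h0
  rw [Real.log_mul (by positivity) hne.ne'] at h1
  have h2 := mul_le_mul_of_nonneg_left h1 (show (0 : ℝ) ≤ (1 / 4) ^ m by positivity)
  unfold zeroRate
  linarith [(abs_le.1 hG).2]

/-- In the basin of 0 the term `q * w.2` dominates, so the lower bound holds at all late times, not
just at one of two consecutive ones. -/
theorem eventually_le_zeroForm_of_mem_P0 {v₀ q : ℂ} (h : q ∈ P0 v₀) :
    ∃ ε : ℝ, 0 < ε ∧ ∀ᶠ m in atTop, ε * ‖lift v₀ m q‖ ≤ ‖zeroForm q (lift v₀ m q)‖ := by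
  have hq := norm_pos_iff.2 h.1
  have h1 := h.2
  simp_rw [orbit_eq_proj] at h1
  refine ⟨‖q‖ / 2, by positivity, ?_⟩
  filter_upwards [eventually_lt_of_tendsto_zero h1 (show 0 < min 1 (‖q‖ / 2) by positivity)]
    with m hm
  set w := lift v₀ m q
  have h2 : ‖w.1‖ ≤ ‖w.2‖ := hm.le.trans
    (mul_le_of_le_one_left (norm_nonneg _) (min_le_left _ _))
  have h3 : ‖w.1‖ ≤ ‖q‖ / 2 * ‖w.2‖ := hm.le.trans
    (mul_le_mul_of_nonneg_right (min_le_right _ _) (norm_nonneg _))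
  rw [Prod.norm_def, max_eq_right h2]
  have h4 : ‖q * w.2‖ - ‖w.1‖ ≤ ‖zeroForm q w‖ := by
    simpa only [zeroForm, sub_neg_eq_add, norm_neg] using norm_sub_norm_le (q * w.2) (-w.1)
  rw [norm_mul] at h4
  linarith

theorem tendsto_add_const_mul_pow (a c : ℝ) :
    Tendsto (fun n : ℕ => a + c * (1 / 4) ^ n) atTop (𝓝 a) := by
  simpa using ((tendsto_pow_atTop_nhds_zero_of_lt_one (r := (1 / 4 : ℝ)) (by norm_num)
    (by norm_num)).const_mul c).const_add a

/-- A holomorphic function on a ball with real part zero near the center is constant. -/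
theorem re_eq_zero_of_eventually {d : ℂ → ℂ} {c : ℂ} {r : ℝ}
    (hd : DifferentiableOn ℂ d (Metric.ball c r)) (h : ∀ᶠ z in 𝓝 c, (d z).re = 0) {z : ℂ}
    (hz : z ∈ Metric.ball c r) : (d z).re = 0 := by
  have hc := Metric.mem_ball_self (x := c) (Metric.pos_of_mem_ball hz)
  have han := hd.analyticOnNhd Metric.isOpen_ball
  have h0 : (d c).re = 0 := h.self_of_nhds
  rcases (han c hc).eventually_constant_or_nhds_le_map_nhds with h1 | h1
  · have h2 := han.eqOn_of_preconnected_of_eventuallyEq (g := fun _ => d c) analyticOnNhd_const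
      (Metric.isPreconnected_ball) hc h1
    rw [h2 hz]
    exact h0
  -- By the open mapping alternative, a neighbourhood of `d c` would lie in the imaginary axis; a
  -- small real shift leaves it.
  · exfalso
    have h2 : ∀ᶠ y in 𝓝 (d c), y.re = 0 := h1 h
    have h3 : Tendsto (fun t : ℝ => d c + (t : ℂ)) (𝓝[≠] 0) (𝓝 (d c)) := by
      have : Continuous fun t : ℝ => d c + (t : ℂ) := by fun_prop
      simpa using (this.tendsto 0).mono_left nhdsWithin_le_nhds
    obtain ⟨t, ht, ht0⟩ := ((h3.eventually h2).and self_mem_nhdsWithin).exists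
    rw [Complex.add_re, h0, Complex.ofReal_re, zero_add] at ht
    exact ht0 ht

open Metric in
/-- Near a point of the basin of `0`, where `zeroForm` has no zeros, the escape rate is the real
part of a holomorphic function. -/
theorem exists_holomorphic_escape_rate {v₀ c : ℂ} {R : ℝ} (hR : 0 < R) {K : Set ℂ}
    (hK : IsCompact K) (hK0 : (0 : ℂ) ∉ K) (hK1 : (1 : ℂ) ∉ K) (hsub : ball c (8 * R) ⊆ K)
    (hc : c ∈ P0 v₀) {M : ℕ} (hM : ∀ n, ∀ z ∈ K, zeroForm z (lift v₀ (n + M) z) ≠ 0)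
    {G : ℂ → ℝ} {L : ℝ}
    (hG : ∀ q ∈ K, ∀ m, |(1 / 4) ^ m * Real.log ‖lift v₀ m q‖ - G q| ≤ L * (1 / 4) ^ m) :
    ∃ ψ : ℂ → ℂ, DifferentiableOn ℂ ψ (ball c (2 * R)) ∧
      ∀ z ∈ ball c (2 * R), (ψ z).re = G z := by
  have hKne : ∀ z ∈ K, z ≠ 0 := fun z hz h => hK0 (h ▸ hz)
  have hcK : c ∈ K := hsub (mem_ball_self (by positivity))
  obtain ⟨B, hB⟩ := hK.isBounded.exists_norm_le
  obtain ⟨ε, hε, hmax⟩ := exists_le_max_norm_zeroForm hK hK0 hK1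
  have hpow0 : ∀ n : ℕ, (0 : ℝ) ≤ (1 / 4) ^ n := fun n => by positivity
  have hpow1 : ∀ n : ℕ, (1 / 4 : ℝ) ^ n ≤ 1 := fun n => pow_le_one₀ (by norm_num) (by norm_num)
  have hlog : ∀ n, ∃ χ : ℂ → ℂ, DifferentiableOn ℂ χ (ball c (8 * R)) ∧
      (∀ z ∈ ball c (8 * R), Complex.exp (χ z) = zeroForm z (lift v₀ (n + M) z)) ∧
      χ c = Complex.log (zeroForm c (lift v₀ (n + M) c)) := fun n => by
    refine exists_log_of_ne_zero (f := fun z => zeroForm z (lift v₀ (n + M) z)) (by positivity) ?_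
      fun z hz => hM n z (hsub hz)
    have := differentiable_lift v₀ (n + M)
    unfold zeroForm
    fun_prop
  choose χ hχd hχe hχc using hlog
  set ψ : ℕ → ℂ → ℂ := fun n z => (((1 / 4) ^ (n + M) : ℝ) : ℂ) * χ n z with hψ
  have hψd : ∀ n, DifferentiableOn ℂ (ψ n) (ball c (8 * R)) := fun n => (hχd n).const_mul _
  have hψre : ∀ n, ∀ z ∈ ball c (8 * R), (ψ n z).re = zeroRate v₀ (n + M) z := by
    intro n z hz
    rw [hψ, zeroRate, ← hχe n z hz, Complex.norm_exp, Real.log_exp, Complex.re_ofReal_mul]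
  set C := L + Real.log (B + 1)
  have hupper : ∀ n, ∀ z ∈ ball c (8 * R), (ψ n z).re ≤ G z + C * (1 / 4) ^ (n + M) := by
    intro n z hz
    have hz' := hsub hz
    rw [hψre n z hz]
    exact zeroRate_le (hKne z hz') (hB z hz') (hG z hz' _) (hM n z hz')
  have hlower : ∀ n, ∀ z ∈ ball c (8 * R),
      G z - |L - Real.log ε| * (1 / 4) ^ (n + M) ≤ max (ψ n z).re (ψ (n + 1) z).re := by
    intro n z hz
    have hz' := hsub hz
    rw [hψre n z hz, hψre (n + 1) z hz]
    have h1 := mul_le_mul_of_nonneg_right (le_abs_self (L - Real.log ε)) (hpow0 (n + M))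
    rcases hmax z hz' (lift v₀ (n + M) z) with h | h
    · exact le_max_of_le_left ((by linarith : _ ≤ _).trans
        (zeroRate_ge (hKne z hz') hε (hG z hz' _) h))
    · rw [← lift_succ, add_right_comm] at h
      have h2 := zeroRate_ge (hKne z hz') hε (hG z hz' _) h
      have h3 : |L - Real.log ε| * (1 / 4) ^ (n + 1 + M) ≤ |L - Real.log ε| * (1 / 4) ^ (n + M) :=
        mul_le_mul_of_nonneg_left
          (pow_le_pow_of_le_one (by norm_num) (by norm_num) (by omega)) (abs_nonneg _)
      have h4 := mul_le_mul_of_nonneg_right (le_abs_self (L - Real.log ε)) (hpow0 (n + 1 + M))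
      exact le_max_of_le_right (by linarith)
  have hP0 : ∀ z ∈ ball c (8 * R), z ∈ P0 v₀ → Tendsto (fun n => (ψ n z).re) atTop (𝓝 (G z)) := by
    intro z hz hzP
    obtain ⟨δ, hδ, hev⟩ := eventually_le_zeroForm_of_mem_P0 hzP
    have hz' := hsub hz
    refine tendsto_of_tendsto_of_tendsto_of_le_of_le'
      ((tendsto_add_atTop_iff_nat M).2 (tendsto_add_const_mul_pow (G z) (-(L - Real.log δ))))
      ((tendsto_add_atTop_iff_nat M).2 (tendsto_add_const_mul_pow (G z) C)) ?_
      (Eventually.of_forall fun n => hupper n z hz)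
    filter_upwards [(tendsto_add_atTop_nat M).eventually hev] with n hn
    rw [hψre n z hz]
    have := zeroRate_ge (hKne z hz') hδ (hG z hz' _) hn
    linarith
  -- At the center the real parts converge since `c` is in the basin, and the imaginary parts are
  -- bounded because the principal logarithm is chosen there.
  obtain ⟨B₁, hB₁⟩ : ∃ B₁, ∀ n, ‖ψ n c‖ ≤ B₁ := by
    have hc8 : c ∈ ball c (8 * R) := mem_ball_self (by positivity)
    obtain ⟨b, hb⟩ := (isBounded_range_of_tendsto _ (hP0 c hc8 hc)).exists_norm_le
    refine ⟨b + Real.pi, fun n => (Complex.norm_le_abs_re_add_abs_im _).trans (add_le_add ?_ ?_)⟩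
    · exact hb _ (Set.mem_range_self n)
    · rw [hψ, Complex.im_ofReal_mul, hχc, Complex.log_im, abs_mul, abs_of_nonneg (hpow0 _)]
      exact (mul_le_of_le_one_left (abs_nonneg _) (hpow1 _)).trans (Complex.abs_arg_le_pi _)
  set M₀ := |Real.log ‖((v₀, 1) : ℂ × ℂ)‖| + |L| + |C| + 1
  have hM₀ : 0 < M₀ := by positivity
  have hreM : ∀ n, ∀ z ∈ ball c (8 * R), (ψ n z).re ≤ M₀ := by
    intro n z hz
    have h1 := hG z (hsub hz) 0
    simp only [pow_zero, one_mul, mul_one] at h1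
    have h2 : G z ≤ |Real.log ‖((v₀, 1) : ℂ × ℂ)‖| + |L| := by
      have h3 : lift v₀ 0 z = (v₀, 1) := rfl
      rw [h3] at h1
      linarith [(abs_le.1 h1).1, le_abs_self (Real.log ‖((v₀, 1) : ℂ × ℂ)‖), le_abs_self L]
    have h3 : C * (1 / 4) ^ (n + M) ≤ |C| :=
      (mul_le_mul_of_nonneg_right (le_abs_self C) (hpow0 _)).trans
        (mul_le_of_le_one_right (abs_nonneg _) (hpow1 _))
    linarith [hupper n z hz]
  have hbound : ∀ n, ∀ z ∈ ball c (4 * R), ‖ψ n z‖ ≤ 2 * M₀ + 3 * B₁ := fun n z hz => by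
    have h8 : 2 * (4 * R) = 8 * R := by ring
    exact norm_le_of_re_le (by positivity) hM₀ (h8 ▸ hψd n) (h8 ▸ hreM n) (hB₁ n) hz
  have h4 : 2 * (2 * R) = 4 * R := by ring
  have hsub48 : ball c (4 * R) ⊆ ball c (8 * R) := ball_subset_ball (by linarith)
  -- Consecutive rates are extracted together, since only the larger of the two is bounded below by
  -- `G`.
  obtain ⟨φ, hφ, g, -, hg⟩ := exists_subseq_tendstoUniformlyOn (R := 2 * R) (c := c)
    (f := fun n z => (ψ n z, ψ (n + 1) z)) (by positivity)
    (fun n => by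
      rw [h4]
      exact ((hψd n).mono hsub48).prodMk ((hψd (n + 1)).mono hsub48))
    (fun n z hz => by
      rw [h4] at hz
      exact max_le (hbound n z hz) (hbound (n + 1) z hz))
  have hsub2c : ball c (2 * R) ⊆ closedBall c (2 * R) := ball_subset_closedBall
  have hsub28 : ball c (2 * R) ⊆ ball c (8 * R) := ball_subset_ball (by linarith)
  have hgd : DifferentiableOn ℂ g (ball c (2 * R)) :=
    (hg.mono hsub2c).tendstoLocallyUniformlyOn.differentiableOn
      (Eventually.of_forall fun n => ((hψd _).mono hsub28).prodMk ((hψd _).mono hsub28))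
      isOpen_ball
  have hlim1 : ∀ z ∈ ball c (2 * R), Tendsto (fun k => (ψ (φ k) z).re) atTop (𝓝 (g z).1.re) :=
    fun z hz => (Complex.continuous_re.tendsto _).comp
      ((continuous_fst.tendsto _).comp (hg.tendsto_at (hsub2c hz)))
  have hlim2 : ∀ z ∈ ball c (2 * R),
      Tendsto (fun k => (ψ (φ k + 1) z).re) atTop (𝓝 (g z).2.re) :=
    fun z hz => (Complex.continuous_re.tendsto _).comp
      ((continuous_snd.tendsto _).comp (hg.tendsto_at (hsub2c hz)))
  have hconst : ∀ a b : ℝ, Tendsto (fun k => a + b * (1 / 4) ^ (φ k + M)) atTop (𝓝 a) :=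
    fun a b => ((tendsto_add_atTop_iff_nat M).2 (tendsto_add_const_mul_pow a b)).comp
      hφ.tendsto_atTop
  have hle : ∀ z ∈ ball c (2 * R), (g z).1.re ≤ G z := fun z hz =>
    le_of_tendsto_of_tendsto' (hlim1 z hz) (hconst (G z) C) fun k => hupper _ z (hsub28 hz)
  have hge : ∀ z ∈ ball c (2 * R), G z ≤ max (g z).1.re (g z).2.re := fun z hz =>
    le_of_tendsto_of_tendsto' (hconst (G z) (-|L - Real.log ε|)) ((hlim1 z hz).max (hlim2 z hz))
      fun k => by
        have := hlower (φ k) z (hsub28 hz)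
        rwa [neg_mul, ← sub_eq_add_neg]
  -- Near `c` both limits have real part `G`, and equality of the real parts propagates to the whole
  -- ball.
  have heq : ∀ z ∈ ball c (2 * R), ((g z).1 - (g z).2).re = 0 := by
    intro z hz
    refine re_eq_zero_of_eventually (d := fun z => (g z).1 - (g z).2) (hgd.fst.sub hgd.snd) ?_ hz
    filter_upwards [isOpen_ball.mem_nhds (mem_ball_self (x := c) (by positivity : 0 < 2 * R)),
      (isOpen_P0 v₀).mem_nhds hc] with w hw hwP
    have h5 := hP0 w (hsub28 hw) hwP
    rw [Complex.sub_re, tendsto_nhds_unique (hlim1 w hw) (h5.comp hφ.tendsto_atTop),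
      tendsto_nhds_unique (hlim2 w hw)
        (((tendsto_add_atTop_iff_nat 1).2 h5).comp hφ.tendsto_atTop), sub_self]
  refine ⟨fun z => (g z).1, hgd.fst, fun z hz => le_antisymm (hle z hz) ?_⟩
  have h5 := hge z hz
  rwa [← sub_eq_zero.1 ((Complex.sub_re _ _).symm.trans (heq z hz)), max_self] at h5

-- Multiplying the lift by `exp (-4 ^ n ψ)` does not move its projection and brings its norm into
-- `[exp (-L), exp L]`.
open Metric in
theorem isPassive_of_escape_rate_eq_re {v₀ q₀ c : ℂ} {R : ℝ} (hq₀ : q₀ ∈ ball c R) {K : Set ℂ}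
    (hK0 : (0 : ℂ) ∉ K) (hsub : ball c (2 * R) ⊆ K) {G : ℂ → ℝ} {L : ℝ}
    (hG : ∀ q ∈ K, ∀ m, |(1 / 4) ^ m * Real.log ‖lift v₀ m q‖ - G q| ≤ L * (1 / 4) ^ m)
    {ψ : ℂ → ℂ} (hψd : DifferentiableOn ℂ ψ (ball c (2 * R)))
    (hψ : ∀ z ∈ ball c (2 * R), (ψ z).re = G z) : IsPassive v₀ q₀ := by
  have hR : 0 < R := pos_of_mem_ball hq₀
  have hsubR : ball c R ⊆ ball c (2 * R) := ball_subset_ball (by linarith)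
  have hKne : ∀ z ∈ K, z ≠ 0 := fun z hz h => hK0 (h ▸ hz)
  set w : ℕ → ℂ → ℂ × ℂ := fun n z => Complex.exp (-((4 ^ n : ℝ) : ℂ) * ψ z) • lift v₀ n z with hw
  have hnorm : ∀ n, ∀ z ∈ ball c (2 * R),
      ‖w n z‖ = Real.exp (Real.log ‖lift v₀ n z‖ - 4 ^ n * G z) := by
    intro n z hz
    have hne := norm_pos_iff.2 (lift_ne_zero v₀ (hKne z (hsub hz)) n)
    rw [hw, norm_smul, Complex.norm_exp, ← Complex.ofReal_neg, Complex.re_ofReal_mul, hψ z hz,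
      sub_eq_neg_add, Real.exp_add, Real.exp_log hne, neg_mul]
  have hdiff : ∀ n, ∀ z ∈ ball c (2 * R), |Real.log ‖lift v₀ n z‖ - 4 ^ n * G z| ≤ L := by
    intro n z hz
    have h1 := mul_le_mul_of_nonneg_left (hG z (hsub hz) n) (show (0 : ℝ) ≤ 4 ^ n by positivity)
    have h4 : (4 : ℝ) ^ n * (1 / 4) ^ n = 1 := by
      rw [← mul_pow]
      norm_num
    rw [← abs_of_nonneg (show (0 : ℝ) ≤ 4 ^ n by positivity), ← abs_mul,
      abs_of_nonneg (show (0 : ℝ) ≤ 4 ^ n by positivity), mul_sub, ← mul_assoc, h4, one_mul,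
      mul_left_comm, h4, mul_one] at h1
    exact h1
  refine isPassive_of_bounded_lift (C := Real.exp L) (Real.exp_pos (-L)) (w := w) hq₀
    (fun h => hK0 (hsub (hsubR h))) ?_ ?_ ?_ ?_
  · intro n
    exact ((hψd.const_mul _).cexp).smul (differentiable_lift v₀ n).differentiableOn
  · intro n z hz
    rw [hnorm n z hz]
    exact Real.exp_le_exp.2 (abs_le.1 (hdiff n z hz)).2
  · intro n z hz
    rw [hnorm n z (hsubR hz)]
    exact Real.exp_le_exp.2 (abs_le.1 (hdiff n z (hsubR hz))).1
  · intro n z hz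
    rw [orbit_eq_proj, hw, proj_smul (Complex.exp_ne_zero _)]

open Metric in
theorem mem_accumulationSet_of_mem_A {v₀ q₀ : ℂ} (hA : q₀ ∈ A v₀) (h1 : q₀ ≠ 1) :
    q₀ ∈ accumulationSet v₀ := by
  intro U hU
  by_contra hfreq
  rw [not_frequently] at hfreq
  refine hA.2 ?_
  have hcl : q₀ ∈ closure (P0 v₀) := by
    rw [← frontier_P0_inter] at hA
    exact frontier_subset_closure hA.1
  obtain ⟨ρ, hρ, hρU⟩ := nhds_basis_closedBall.mem_iff.1
    (inter_mem hU (inter_mem (isOpen_ne.mem_nhds hA.1) (isOpen_ne.mem_nhds h1)))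
  obtain ⟨M, hM⟩ := eventually_atTop.1 hfreq
  -- With `R = ρ / 9`, the ball of radius `8R` about `c` stays in the closed ball of radius `ρ`, and
  -- `q₀` lies within `R` of `c`.
  obtain ⟨c, hc, hdist⟩ := Metric.mem_closure_iff.1 hcl (ρ / 9) (by positivity)
  have hsub : ball c (8 * (ρ / 9)) ⊆ closedBall q₀ ρ := by
    intro z hz
    rw [mem_ball] at hz
    rw [mem_closedBall]
    rw [dist_comm] at hdist
    linarith [dist_triangle z c q₀]
  have hK0 : (0 : ℂ) ∉ closedBall q₀ ρ := fun h => (hρU h).2.1 rfl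
  have hK1 : (1 : ℂ) ∉ closedBall q₀ ρ := fun h => (hρU h).2.2 rfl
  obtain ⟨G, L, hG⟩ := exists_escape_rate v₀ (isCompact_closedBall q₀ ρ) hK0
  obtain ⟨ψ, hψd, hψ⟩ := exists_holomorphic_escape_rate (by positivity)
    (isCompact_closedBall q₀ ρ) hK0 hK1 hsub hc (M := M) (fun n z hz h0 =>
      hM (n + M) (by omega) ⟨z, (hρU hz).1, by rw [Z_eq_zeroForm, h0, mul_zero]⟩) hG
  exact isPassive_of_escape_rate_eq_re (by rwa [mem_ball]) hK0
    ((ball_subset_ball (by linarith)).trans hsub) hG hψd hψ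

/-! ### Active parameters lie in the continuous accumulation locus -/

/-- The punctured disc is the image of a half-plane under a translated exponential. -/
theorem isPreconnected_ball_diff_singleton (c : ℂ) {r : ℝ} (hr : 0 < r) :
    IsPreconnected (Metric.ball c r \ {c}) := by
  have himg : (fun z => c + Complex.exp z) '' {z | z.re < Real.log r} = Metric.ball c r \ {c} := by
    ext y
    simp only [Set.mem_image, Set.mem_ofPred_eq, Set.mem_sdiff, Metric.mem_ball,
      Set.mem_singleton_iff, dist_eq_norm]
    constructor
    · rintro ⟨z, hz, rfl⟩
      refine ⟨?_, by simp⟩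
      rw [add_sub_cancel_left, Complex.norm_exp]
      exact (Real.lt_log_iff_exp_lt hr).1 hz
    · rintro ⟨h1, h2⟩
      have h3 : y - c ≠ 0 := sub_ne_zero.2 h2
      refine ⟨Complex.log (y - c), ?_, by rw [Complex.exp_log h3, add_sub_cancel]⟩
      rw [Complex.log_re]
      exact Real.log_lt_log (norm_pos_iff.2 h3) h1
  rw [← himg]
  exact (convex_halfSpace_re_lt _).isPreconnected.image _ (by fun_prop)

/-- Around an isolated active point, a punctured disc would meet each basin without meeting its
boundary, hence by connectedness lie in both disjoint basins. -/
theorem accPt_A {v₀ q₀ : ℂ} (hA : q₀ ∈ A v₀) : AccPt q₀ (𝓟 (A v₀)) := by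
  rw [accPt_iff_nhds]
  intro U hU
  by_contra! hno
  obtain ⟨ρ, hρ, hρU⟩ := Metric.nhds_basis_ball.mem_iff.1
    (inter_mem hU (isOpen_ne.mem_nhds hA.1))
  have hfr : ∀ P : Set ℂ, IsOpen P → frontier P ∩ {0}ᶜ = A v₀ →
      Metric.ball q₀ ρ \ {q₀} ⊆ P := by
    intro P hP hPA
    have hq : q₀ ∈ frontier P := by
      rw [← hPA] at hA
      exact hA.1
    rw [hP.frontier_eq] at hq
    obtain ⟨z, hz, hzP⟩ := mem_closure_iff.1 hq.1 _ Metric.isOpen_ball (Metric.mem_ball_self hρ)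
    refine (isPreconnected_ball_diff_singleton q₀ hρ).subset_of_closure_inter_subset hP
      ⟨z, ⟨hz, fun h => hq.2 (h ▸ hzP)⟩, hzP⟩ ?_
    rintro y ⟨hy, hyb, hyq⟩
    by_contra hyP
    refine hyq (hno y ⟨(hρU hyb).1, ?_⟩)
    rw [← hPA, hP.frontier_eq]
    exact ⟨⟨hy, hyP⟩, (hρU hyb).2⟩
  have h1 := hfr _ (isOpen_P0 v₀) (frontier_P0_inter v₀)
  have h2 := hfr _ (isOpen_PInfty v₀) (frontier_PInfty_inter v₀)
  have h3 : q₀ + (ρ / 2 : ℝ) ∈ Metric.ball q₀ ρ \ {q₀} := by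
    constructor
    · rw [Metric.mem_ball, dist_eq_norm, add_sub_cancel_left, Complex.norm_real, Real.norm_eq_abs,
        abs_of_pos (by positivity)]
      linarith
    · simp [hρ.ne']
  exact Set.disjoint_left.1 (disjoint_P0_PInfty v₀) (h1 h3) (h2 h3)

theorem A_subset_B (v₀ : ℂ) : A v₀ ⊆ B v₀ := by
  intro q₀ hA
  have hacc : ∀ U ∈ 𝓝 q₀, ∃ q ∈ U, q ∈ accumulationSet v₀ ∧ q ≠ q₀ := by
    intro U hU
    by_cases h1 : q₀ = 1
    · obtain ⟨q, ⟨hqU, hqA⟩, hq⟩ := accPt_iff_nhds.1 (accPt_A hA) U hU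
      exact ⟨q, hqU, mem_accumulationSet_of_mem_A hqA (h1 ▸ hq), hq⟩
    · obtain ⟨q, ⟨hqU, hqA⟩, hq⟩ := accPt_iff_nhds.1 (accPt_A hA) _
        (inter_mem hU (isOpen_ne.mem_nhds h1))
      exact ⟨q, hqU.1, mem_accumulationSet_of_mem_A hqA hqU.2, hq⟩
  refine ⟨fun U hU => ?_, accPt_iff_nhds.2 fun U hU => ?_⟩
  · obtain ⟨q, hq, hqacc, -⟩ := hacc (interior U) (interior_mem_nhds.2 hU)
    exact hqacc U (mem_interior_iff_mem_nhds.1 hq)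
  · obtain ⟨q, hq, hqacc, hne⟩ := hacc U hU
    exact ⟨q, ⟨hq, hqacc⟩, hne⟩

/-! ### Absence of zeros near the basins -/

theorem norm_eq_of_Z_eq_zero {v₀ z : ℂ} {m : ℕ} (hz : z ≠ 0) (h : Z m z v₀ = 0) :
    ‖(lift v₀ m z).1‖ = ‖z‖ * ‖(lift v₀ m z).2‖ ∧ 0 < ‖(lift v₀ m z).2‖ := by
  rw [Z_eq_zeroForm, mul_eq_zero, or_iff_right hz, zeroForm] at h
  have h1 : (lift v₀ m z).1 = -(z * (lift v₀ m z).2) := by linear_combination h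
  refine ⟨by rw [h1, norm_neg, norm_mul], norm_pos_iff.2 fun h2 => ?_⟩
  exact lift_ne_zero v₀ hz m (Prod.ext (by simp [h1, h2]) h2)

/-- A zero `z` near `q` needs `|v| = |z| > |q| / 2`, while the trap forces `|v| ≤ r / 2 ^ k`
uniformly near `q`. -/
theorem notMem_accumulationSet_of_mem_P0 {v₀ q : ℂ} (h : q ∈ P0 v₀) :
    q ∉ accumulationSet v₀ := by
  intro hacc
  obtain ⟨r, m, hrm⟩ := eventually_trap_of_mem_P0 h
  have hq := norm_pos_iff.2 h.1
  have h1 : ∀ᶠ z : ℂ in 𝓝 q, ‖q‖ / 2 < ‖z‖ :=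
    continuous_norm.continuousAt.eventually_const_lt (by linarith)
  have h2 := (tendsto_geometric_mul r).eventually_lt_const (show 0 < ‖q‖ / 2 by positivity)
  obtain ⟨N, hN⟩ := eventually_atTop.1 h2
  obtain ⟨n, ⟨z, hz, hZ⟩, hn⟩ :=
    ((hacc _ (hrm.and h1)).and_eventually (eventually_ge_atTop (m + N))).exists
  obtain ⟨k, rfl⟩ := Nat.exists_eq_add_of_le ((Nat.le_add_right m N).trans hn)
  obtain ⟨heq, hpos⟩ := norm_eq_of_Z_eq_zero hz.1.1 hZ
  have h3 := hz.1.2 k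
  rw [heq] at h3
  have h4 := le_of_mul_le_mul_right h3 hpos
  linarith [hN k (by omega), hz.2]

theorem notMem_accumulationSet_of_mem_PInfty {v₀ q : ℂ} (h : q ∈ PInfty v₀) :
    q ∉ accumulationSet v₀ := by
  intro hacc
  obtain ⟨r, m, hrm⟩ := eventually_trap_of_mem_PInfty h
  have h1 : ∀ᶠ z : ℂ in 𝓝 q, ‖z‖ < ‖q‖ + 1 :=
    continuous_norm.continuousAt.eventually_lt_const (by linarith)
  have h2 := (tendsto_geometric_mul r).eventually_lt_const
    (show 0 < (‖q‖ + 1)⁻¹ by positivity)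
  obtain ⟨N, hN⟩ := eventually_atTop.1 h2
  obtain ⟨n, ⟨z, hz, hZ⟩, hn⟩ :=
    ((hacc _ (hrm.and h1)).and_eventually (eventually_ge_atTop (m + N))).exists
  obtain ⟨k, rfl⟩ := Nat.exists_eq_add_of_le ((Nat.le_add_right m N).trans hn)
  obtain ⟨heq, hpos⟩ := norm_eq_of_Z_eq_zero hz.1.1 hZ
  have h3 := hz.1.2 k
  rw [heq, ← mul_assoc] at h3
  have h4 : 1 ≤ r / 2 ^ k * ‖z‖ := le_of_mul_le_mul_right (by rwa [one_mul]) hpos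
  have hz0 := norm_pos_iff.2 hz.1.1
  have h5 : r / 2 ^ k * ‖z‖ < (‖q‖ + 1)⁻¹ * (‖q‖ + 1) :=
    mul_lt_mul' (hN k (by omega)).le hz.2 hz0.le (by positivity)
  rw [inv_mul_cancel₀ (by positivity)] at h5
  linarith

end DiamondPotts

end

theorem mainTheorem3 (v₀ : ℂ) :
    IsOpen (DiamondPotts.P0 v₀) ∧
    IsOpen (DiamondPotts.PInfty v₀) ∧
    frontier (DiamondPotts.P0 v₀) ∩ {0}ᶜ = DiamondPotts.A v₀ ∧
    frontier (DiamondPotts.PInfty v₀) ∩ {0}ᶜ = DiamondPotts.A v₀ ∧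
    frontier (DiamondPotts.P0 v₀) ∩ {0}ᶜ = frontier (DiamondPotts.PInfty v₀) ∩ {0}ᶜ ∧
    frontier (DiamondPotts.P0 v₀) ∩ {0}ᶜ ⊆ DiamondPotts.B v₀ ∧
    frontier (DiamondPotts.PInfty v₀) ∩ {0}ᶜ ⊆ DiamondPotts.B v₀ ∧
    Disjoint (DiamondPotts.B v₀) (DiamondPotts.P0 v₀ ∪ DiamondPotts.PInfty v₀) := by
  have h0 := DiamondPotts.frontier_P0_inter v₀
  have hinf := DiamondPotts.frontier_PInfty_inter v₀
  refine ⟨DiamondPotts.isOpen_P0 v₀, DiamondPotts.isOpen_PInfty v₀, h0, hinf, h0.trans hinf.symm,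
    h0.trans_subset (DiamondPotts.A_subset_B v₀), hinf.trans_subset (DiamondPotts.A_subset_B v₀),
    Set.disjoint_left.2 ?_⟩
  rintro q hB (h | h)
  · exact DiamondPotts.notMem_accumulationSet_of_mem_P0 h hB.1
  · exact DiamondPotts.notMem_accumulationSet_of_mem_PInfty h hB.1
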